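/- Let $k\ge 1$ be an integer. Let $J^k(\mathbb R)$ be $\mathbb R^{k+2}$, with points written $(x,u_k,\ldots,u_0)$, equipped with the group operation \[ (x,u_k,\ldots,u_0)\odot(y,v_k,\ldots,v_0)=(x+y,w_k,\ldots,w_0),\qquad w_s=u_s+v_s+\sum_{j=s+1}^{k}u_j\frac{y^{j-s}}{(j-s)!},\quad 0\le s\le k . \] A curve in $J^k(\mathbb R)$ is horizontal if it is absolutely continuous as a curve in $\mathbb R^{k+2}$ and its coordinates satisfy $u_j'=u_{j+1}x'$ almost everywhere for $j=0,\ldots,k-1$; its length is $\int\sqrt{(x')^2+(u_k')^2}$, and the Carnot–Carathéodory distance $d_{cc}(p,q)$ is the infimum of the lengths of the horizontal curves connecting $p$ to $q$. Let $\dim_H$ denote Hausdorff dimension with respect to $d_{cc}$ (with $\dim_H\emptyset=0$). For $f\in C^\infty(\mathbb R)$ and $y\in\mathbb R$ let $j^k_y(f)=(y,f^{(k)}(y),\ldots,f'(y),f(y))\in J^k(\mathbb R)$. For $t\in\mathbb R$ and $p=(x,u_k,\ldots,u_0)\in J^k(\mathbb R)$ put \[ J_{f,t}(p)=j^k_{x-t}(f),\qquad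 V_{f,t}(p)=p\odot j^k_{x-t}(f)^{-1}. \] **Theorem.** Fix $f\in C^\infty(\mathbb R)$ and $t\in\mathbb R$. For all $E\subset J^k(\mathbb R)$, \[ 0\le\dim_H J_{f,t}(E)\le 1\qquad\text{and}\qquad 0\le\dim_H V_{f,t}(E)\le\frac{(k+1)(k+2)}{2}. \] Moreover, for every pair $(\alpha,\beta)\in[0,1]\times\left[0,\frac{(k+1)(k+2)}{2}\right]$ there exists a set $E_{\alpha,\beta}\subset J^k(\mathbb R)$ (depending on $f$ and $t$) such that \[ \dim_H J_{f,t}(E_{\alpha,\beta})=\alpha\qquad\text{and}\qquad\dim_H V_{f,t}(E_{\alpha,\beta})=\beta . \] -/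

import Mathlib

open scoped ENNReal ContDiff Nat

noncomputable section

/-- The jet space `J^k(ℝ)`, identified with `ℝ^{k+2}`: a point `(x, u_k, …, u_0)` is stored as its
base point `x` together with the family `u`, where `u j` is the coordinate `u_j`. -/
@[ext]
structure Jet (k : ℕ) where
  x : ℝ
  u : Fin (k + 1) → ℝ

namespace Jet

variable {k : ℕ}

/-! ### The group structure -/

/-- The group operation `⊙`:
`z = x + y` and `w_s = u_s + v_s + ∑_{j > s} u_j y^{j-s} / (j-s)!`. -/
instance : Mul (Jet k) where
  mul p q :=
    ⟨p.x + q.x, fun s => p.u s + q.u s +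
      ∑ j ∈ Finset.Ioi s, p.u j * (q.x ^ ((j : ℕ) - (s : ℕ)) / ((j : ℕ) - (s : ℕ))!)⟩

instance : One (Jet k) where
  one := ⟨0, fun _ => 0⟩

instance : Inv (Jet k) where
  inv p := ⟨-p.x, fun s =>
    -∑ j ∈ Finset.Ici s, p.u j * ((-p.x) ^ ((j : ℕ) - (s : ℕ)) / ((j : ℕ) - (s : ℕ))!)⟩

/-- The linear change `u_s ↦ ∑_{j ≥ s} u_j y^{j-s} / (j-s)!` of the coordinates of a jet when its
base point is moved by `y`. It is only used to verify the group axioms. -/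
def taylorShift (y : ℝ) (u : Fin (k + 1) → ℝ) (s : Fin (k + 1)) : ℝ :=
  ∑ j ∈ Finset.Ici s, u j * (y ^ ((j : ℕ) - (s : ℕ)) / ((j : ℕ) - (s : ℕ))!)

theorem mul_x (p q : Jet k) : (p * q).x = p.x + q.x := rfl

theorem mul_u (p q : Jet k) (s : Fin (k + 1)) :
    (p * q).u s = p.u s + q.u s +
      ∑ j ∈ Finset.Ioi s, p.u j * (q.x ^ ((j : ℕ) - (s : ℕ)) / ((j : ℕ) - (s : ℕ))!) := rfl

theorem one_x : (1 : Jet k).x = 0 := rfl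

theorem one_u (s : Fin (k + 1)) : (1 : Jet k).u s = 0 := rfl

theorem inv_x (p : Jet k) : (p⁻¹).x = -p.x := rfl

theorem inv_u (p : Jet k) (s : Fin (k + 1)) :
    (p⁻¹).u s =
      -∑ j ∈ Finset.Ici s, p.u j * ((-p.x) ^ ((j : ℕ) - (s : ℕ)) / ((j : ℕ) - (s : ℕ))!) := rfl

theorem mul_u_eq_taylorShift (p q : Jet k) (s : Fin (k + 1)) :
    (p * q).u s = q.u s + taylorShift q.x p.u s := by
  rw [mul_u, taylorShift, ← Finset.Ioi_insert s, Finset.sum_insert (by simp)]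
  simp
  ring

theorem sum_pow_div_factorial (y z : ℝ) (s i : Fin (k + 1)) (h : s ≤ i) :
    ∑ j ∈ Finset.Icc s i, (y ^ ((i : ℕ) - (j : ℕ)) / ((i : ℕ) - (j : ℕ))!) *
      (z ^ ((j : ℕ) - (s : ℕ)) / ((j : ℕ) - (s : ℕ))!) =
      (y + z) ^ ((i : ℕ) - (s : ℕ)) / ((i : ℕ) - (s : ℕ))! := by
  have h1 : ∑ j ∈ Finset.Icc s i, (y ^ ((i : ℕ) - (j : ℕ)) / ((i : ℕ) - (j : ℕ))!) *
      (z ^ ((j : ℕ) - (s : ℕ)) / ((j : ℕ) - (s : ℕ))!) =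
      ∑ j ∈ (Finset.Icc s i).map Fin.valEmbedding, (y ^ ((i : ℕ) - j) / ((i : ℕ) - j)!) *
      (z ^ (j - (s : ℕ)) / (j - (s : ℕ))!) := by
    rw [Finset.sum_map]; rfl
  rw [h1, Fin.map_valEmbedding_Icc]
  obtain ⟨n, hn⟩ := Nat.exists_eq_add_of_le (show (s : ℕ) ≤ (i : ℕ) from h)
  rw [hn, ← Finset.Ico_succ_right_eq_Icc, Finset.sum_Ico_eq_sum_range]
  have h2 : Order.succ ((s : ℕ) + n) - (s : ℕ) = n + 1 := by
    rw [Order.succ_eq_add_one]; omega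
  rw [h2, add_comm y z, add_tsub_cancel_left, add_pow, Finset.sum_div]
  refine Finset.sum_congr rfl fun m hm => ?_
  have hm' : m ≤ n := by simpa [Nat.lt_succ_iff] using hm
  have h3 : (s : ℕ) + n - ((s : ℕ) + m) = n - m := by omega
  have h4 : (s : ℕ) + m - (s : ℕ) = m := by omega
  rw [h3, h4, Nat.cast_choose ℝ hm']
  have := Nat.factorial_ne_zero n
  have := Nat.factorial_ne_zero m
  have := Nat.factorial_ne_zero (n - m)
  field_simp

theorem taylorShift_taylorShift (y z : ℝ) (u : Fin (k + 1) → ℝ) (s : Fin (k + 1)) :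
    taylorShift z (taylorShift y u) s = taylorShift (y + z) u s := by
  simp only [taylorShift, Finset.sum_mul]
  rw [Finset.sum_comm' (t' := Finset.Ici s) (s' := fun i => Finset.Icc s i)]
  · refine Finset.sum_congr rfl fun i hi => ?_
    rw [← sum_pow_div_factorial y z s i (Finset.mem_Ici.1 hi), Finset.mul_sum]
    exact Finset.sum_congr rfl fun j _ => mul_assoc _ _ _
  · intro a b
    simp only [Finset.mem_Ici, Finset.mem_Icc]
    exact ⟨fun h => ⟨h, h.1.trans h.2⟩, fun h => h.1⟩

theorem taylorShift_zero (u : Fin (k + 1) → ℝ) (s : Fin (k + 1)) : taylorShift 0 u s = u s := by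
  rw [taylorShift, Finset.sum_eq_single s]
  · simp
  · intro j hj hne
    have h1 : s < j := lt_of_le_of_ne (Finset.mem_Ici.1 hj) (Ne.symm hne)
    have h2 : (j : ℕ) - (s : ℕ) ≠ 0 := by
      have : (s : ℕ) < (j : ℕ) := h1
      omega
    simp [h2]
  · simp

theorem taylorShift_add (y : ℝ) (u v : Fin (k + 1) → ℝ) (s : Fin (k + 1)) :
    taylorShift y (fun j => u j + v j) s = taylorShift y u s + taylorShift y v s := by
  simp [taylorShift, add_mul, Finset.sum_add_distrib]

theorem taylorShift_neg (y : ℝ) (u : Fin (k + 1) → ℝ) (s : Fin (k + 1)) :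
    taylorShift y (fun j => -u j) s = -taylorShift y u s := by
  simp [taylorShift]

instance : Group (Jet k) :=
  Group.ofLeftAxioms
    (by
      intro p q r
      ext s
      · simp only [mul_x]; ring
      · have h : (p * q).u = fun j => q.u j + taylorShift q.x p.u j :=
          funext fun j => mul_u_eq_taylorShift p q j
        rw [mul_u_eq_taylorShift, h, taylorShift_add, taylorShift_taylorShift,
          mul_u_eq_taylorShift, mul_u_eq_taylorShift, mul_x]
        ring)
    (by
      intro p
      ext s
      · simp [mul_x, one_x]
      · simp [mul_u, one_u])
    (by
      intro p
      ext s
      · simp [mul_x, inv_x, one_x]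
      · have h : (p⁻¹).u = fun j => -taylorShift (-p.x) p.u j := rfl
        rw [mul_u_eq_taylorShift, h, taylorShift_neg, taylorShift_taylorShift, neg_add_cancel,
          taylorShift_zero, one_u]
        ring)

/-! ### Horizontal curves and the Carnot–Carathéodory metric -/

/-- `γ` is a horizontal curve on `[a, b]`: it is absolutely continuous as a curve in `ℝ^{k+2}` and,
for almost every `s`, its derivative is annihilated by the contact forms
`ω_j = du_j - u_{j+1} dx`, `j = 0, …, k - 1`. -/
structure IsHorizontal (γ : ℝ → Jet k) (a b : ℝ) : Prop where
  ac_x : AbsolutelyContinuousOnInterval (fun s => (γ s).x) a b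
  ac_u : ∀ j, AbsolutelyContinuousOnInterval (fun s => (γ s).u j) a b
  contact : ∀ᵐ s : ℝ, s ∈ Set.Ioo a b → ∀ j : Fin k,
    deriv (fun r => (γ r).u j.castSucc) s = (γ s).u j.succ * deriv (fun r => (γ r).x) s

/-- The speed of a horizontal curve `γ` at time `s`, for the left-invariant metric on the horizontal
bundle in which `X = ∂_x + u_k ∂_{u_{k-1}} + ⋯ + u_1 ∂_{u_0}` and `∂_{u_k}` are orthonormal: a
horizontal velocity is `x' X + u_k' ∂_{u_k}`. -/
def speed (γ : ℝ → Jet k) (s : ℝ) : ℝ :=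
  √(deriv (fun r => (γ r).x) s ^ 2 + deriv (fun r => (γ r).u (Fin.last k)) s ^ 2)

/-- The length of a horizontal curve on `[a, b]`. -/
def curveLength (γ : ℝ → Jet k) (a b : ℝ) : ℝ≥0∞ :=
  ∫⁻ s in Set.Ioo a b, ENNReal.ofReal (speed γ s)

/-- The Carnot–Carathéodory distance: the infimum of the lengths of the horizontal curves that
connect `p` to `q`. -/
def ccDist (p q : Jet k) : ℝ≥0∞ :=
  sInf {L | ∃ (γ : ℝ → Jet k) (a b : ℝ), a ≤ b ∧ IsHorizontal γ a b ∧ γ a = p ∧ γ b = q ∧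
    L = curveLength γ a b}

/-! The following facts verify that the Carnot–Carathéodory distance is a metric. -/

open MeasureTheory Set in
theorem ac_of_eq_integral {f g : ℝ → ℝ} {a b : ℝ} (hab : a ≤ b)
    (hg : IntervalIntegrable g volume a b) (h : ∀ s ∈ Icc a b, f s = f a + ∫ r in a..s, g r) :
    AbsolutelyContinuousOnInterval f a b := by
  have h1 := hg.absolutelyContinuousOnInterval_intervalIntegral (c := a) (by simp)
  rw [absolutelyContinuousOnInterval_iff] at h1 ⊢
  intro ε hε
  obtain ⟨δ, hδ, H⟩ := h1 ε hε
  refine ⟨δ, hδ, fun E hE hl => ?_⟩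
  refine lt_of_le_of_lt (le_of_eq (Finset.sum_congr rfl fun i hi => ?_)) (H E hE hl)
  have h2 := hE.1 i hi
  rw [uIcc_of_le hab] at h2
  rw [h _ h2.1, h _ h2.2, dist_add_left]

open MeasureTheory Set in
theorem eq_integral_of_ac {f : ℝ → ℝ} {a b : ℝ} (hf : AbsolutelyContinuousOnInterval f a b)
    {s t : ℝ} (hs : s ∈ uIcc a b) (ht : t ∈ uIcc a b) :
    ∫ r in s..t, deriv f r = f t - f s :=
  (hf.mono (uIcc_subset_uIcc hs ht)).integral_deriv_eq_sub

open MeasureTheory Set in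
theorem ac_const (c a b : ℝ) : AbsolutelyContinuousOnInterval (fun _ => c) a b :=
  (LipschitzWith.const c).lipschitzOnWith.absolutelyContinuousOnInterval

open MeasureTheory Set in
theorem ac_reflect {f : ℝ → ℝ} {a b : ℝ} (hab : a ≤ b)
    (hf : AbsolutelyContinuousOnInterval f a b) :
    AbsolutelyContinuousOnInterval (fun s => f (-s)) (-b) (-a) := by
  refine ac_of_eq_integral (g := fun s => -deriv f (-s)) (by linarith) ?_ ?_
  · have := (hf.intervalIntegrable_deriv.comp_sub_left 0).symm
    simp only [zero_sub] at this
    exact this.neg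
  · intro s hs
    have h1 : ∫ r in (-b)..s, -deriv f (-r) = -∫ r in (-s)..b, deriv f r := by
      rw [intervalIntegral.integral_neg, intervalIntegral.integral_comp_neg (fun r => deriv f r),
        neg_neg]
    rw [h1, eq_integral_of_ac hf
      (by rw [uIcc_of_le hab]; exact ⟨by linarith [hs.2], by linarith [hs.1]⟩) right_mem_uIcc,
      neg_neg]
    ring

open MeasureTheory Set in
theorem ac_translate {f : ℝ → ℝ} {a b : ℝ} (hab : a ≤ b) (d : ℝ)
    (hf : AbsolutelyContinuousOnInterval f a b) :
    AbsolutelyContinuousOnInterval (fun s => f (s - d)) (a + d) (b + d) := by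
  refine ac_of_eq_integral (g := fun s => deriv f (s - d)) (by linarith)
    (hf.intervalIntegrable_deriv.comp_sub_right d) ?_
  intro s hs
  rw [intervalIntegral.integral_comp_sub_right (fun r => deriv f r), eq_integral_of_ac hf
    (by simp) (by rw [uIcc_of_le hab]; exact ⟨by linarith [hs.1], by linarith [hs.2]⟩)]
  ring

open MeasureTheory Set in
theorem ac_glue {f g : ℝ → ℝ} {a c b : ℝ} (hac : a ≤ c) (hcb : c ≤ b)
    (hf : AbsolutelyContinuousOnInterval f a c) (hg : AbsolutelyContinuousOnInterval g c b)
    (hfg : f c = g c) :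
    AbsolutelyContinuousOnInterval (fun s => if s ≤ c then f s else g s) a b := by
  set G : ℝ → ℝ := fun s => if s ≤ c then deriv f s else deriv g s with hG
  have e1 : ∀ s, s ≤ c → ∫ r in a..s, G r = ∫ r in a..s, deriv f r := by
    intro s hs
    refine intervalIntegral.integral_congr_ae (ae_of_all _ fun r hr => ?_)
    have : r ≤ c := (hr.2).trans (max_le hac hs)
    simp [hG, this]
  have e2 : ∀ s, c ≤ s → ∫ r in c..s, G r = ∫ r in c..s, deriv g r := by
    intro s hs
    refine intervalIntegral.integral_congr_ae (ae_of_all _ fun r hr => ?_)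
    rw [uIoc_of_le hs] at hr
    simp [hG, not_le.2 hr.1]
  have i1 : IntervalIntegrable G volume a c := by
    refine hf.intervalIntegrable_deriv.congr fun r hr => ?_
    rw [uIoc_of_le hac] at hr
    simp [hG, hr.2]
  have i2 : IntervalIntegrable G volume c b := by
    refine hg.intervalIntegrable_deriv.congr fun r hr => ?_
    rw [uIoc_of_le hcb] at hr
    simp [hG, not_le.2 hr.1]
  refine ac_of_eq_integral (g := G) (hac.trans hcb) (i1.trans i2) ?_
  intro s hs
  by_cases hsc : s ≤ c
  · rw [e1 s hsc, eq_integral_of_ac hf (by simp) (by rw [uIcc_of_le hac]; exact ⟨hs.1, hsc⟩)]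
    simp [hsc, hac]
  · have hcs : c ≤ s := (not_le.1 hsc).le
    have i3 : IntervalIntegrable G volume c s :=
      i2.mono_set (by rw [uIcc_of_le hcs, uIcc_of_le hcb]; exact Icc_subset_Icc_right hs.2)
    rw [← intervalIntegral.integral_add_adjacent_intervals i1 i3, e1 c le_rfl, e2 s hcs,
      eq_integral_of_ac hf (by simp) (by simp),
      eq_integral_of_ac hg (by simp) (by rw [uIcc_of_le hcb]; exact ⟨hcs, hs.2⟩)]
    simp [hsc, hac, hfg]

theorem isHorizontal_const (p : Jet k) (a b : ℝ) : IsHorizontal (fun _ => p) a b where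
  ac_x := ac_const _ _ _
  ac_u _ := ac_const _ _ _
  contact := by simp

theorem ccDist_self (p : Jet k) : ccDist p p = 0 := by
  refine le_antisymm (sInf_le ⟨fun _ => p, 0, 0, le_rfl, isHorizontal_const p 0 0, rfl, rfl, ?_⟩)
    zero_le
  simp [curveLength]

open MeasureTheory Set in
theorem IsHorizontal.reflect {γ : ℝ → Jet k} {a b : ℝ} (hab : a ≤ b) (h : IsHorizontal γ a b) :
    IsHorizontal (fun s => γ (-s)) (-b) (-a) where
  ac_x := ac_reflect (f := fun r => (γ r).x) hab h.ac_x
  ac_u j := ac_reflect (f := fun r => (γ r).u j) hab (h.ac_u j)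
  contact := by
    have h1 : ∀ᵐ s : ℝ, -s ∈ Ioo a b → ∀ j : Fin k,
        deriv (fun r => (γ r).u j.castSucc) (-s) =
          (γ (-s)).u j.succ * deriv (fun r => (γ r).x) (-s) :=
      Filter.Tendsto.eventually
        (Measure.measurePreserving_neg (volume : Measure ℝ)).quasiMeasurePreserving.tendsto_ae
        h.contact
    filter_upwards [h1] with s hs hs' j
    have h2 := hs ⟨by linarith [hs'.2], by linarith [hs'.1]⟩ j
    have e1 : deriv (fun r => (γ (-r)).u j.castSucc) s =
        -deriv (fun r => (γ r).u j.castSucc) (-s) :=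
      deriv_comp_neg (fun r => (γ r).u j.castSucc) s
    have e2 : deriv (fun r => (γ (-r)).x) s = -deriv (fun r => (γ r).x) (-s) :=
      deriv_comp_neg (fun r => (γ r).x) s
    rw [e1, e2, h2, mul_neg]

theorem speed_reflect (γ : ℝ → Jet k) (s : ℝ) : speed (fun r => γ (-r)) s = speed γ (-s) := by
  simp only [speed]
  rw [deriv_comp_neg (fun r => (γ r).x), deriv_comp_neg (fun r => (γ r).u (Fin.last k))]
  simp

open MeasureTheory Set in
theorem curveLength_reflect (γ : ℝ → Jet k) (a b : ℝ) :
    curveLength (fun s => γ (-s)) (-b) (-a) = curveLength γ a b := by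
  have h := (Measure.measurePreserving_neg (volume : Measure ℝ)).setLIntegral_comp_preimage_emb
    (MeasurableEquiv.neg ℝ).measurableEmbedding (fun s => ENNReal.ofReal (speed γ s)) (Ioo a b)
  simp only [curveLength, speed_reflect]
  rw [← h]
  simp

theorem ccDist_comm_le (p q : Jet k) : ccDist p q ≤ ccDist q p := by
  refine le_sInf ?_
  rintro L ⟨γ, a, b, hab, hγ, ha, hb, rfl⟩
  exact sInf_le ⟨fun s => γ (-s), -b, -a, by linarith, hγ.reflect hab, by simpa, by simpa,
    (curveLength_reflect γ a b).symm⟩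

open MeasureTheory Set in
theorem IsHorizontal.translate {γ : ℝ → Jet k} {a b : ℝ} (hab : a ≤ b) (d : ℝ)
    (h : IsHorizontal γ a b) : IsHorizontal (fun s => γ (s - d)) (a + d) (b + d) where
  ac_x := ac_translate (f := fun r => (γ r).x) hab d h.ac_x
  ac_u j := ac_translate (f := fun r => (γ r).u j) hab d (h.ac_u j)
  contact := by
    have h1 : ∀ᵐ s : ℝ, s - d ∈ Ioo a b → ∀ j : Fin k,
        deriv (fun r => (γ r).u j.castSucc) (s - d) =
          (γ (s - d)).u j.succ * deriv (fun r => (γ r).x) (s - d) :=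
      Filter.Tendsto.eventually
        (measurePreserving_sub_right (volume : Measure ℝ) d).quasiMeasurePreserving.tendsto_ae
        h.contact
    filter_upwards [h1] with s hs hs' j
    have h2 := hs ⟨by linarith [hs'.1], by linarith [hs'.2]⟩ j
    have e1 : deriv (fun r => (γ (r - d)).u j.castSucc) s =
        deriv (fun r => (γ r).u j.castSucc) (s - d) :=
      deriv_comp_sub_const (fun r => (γ r).u j.castSucc) d s
    have e2 : deriv (fun r => (γ (r - d)).x) s = deriv (fun r => (γ r).x) (s - d) :=
      deriv_comp_sub_const (fun r => (γ r).x) d s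
    rw [e1, e2, h2]

theorem speed_translate (γ : ℝ → Jet k) (d s : ℝ) :
    speed (fun r => γ (r - d)) s = speed γ (s - d) := by
  simp only [speed]
  rw [deriv_comp_sub_const (fun r => (γ r).x),
    deriv_comp_sub_const (fun r => (γ r).u (Fin.last k))]

open MeasureTheory Set in
theorem curveLength_translate (γ : ℝ → Jet k) (a b d : ℝ) :
    curveLength (fun s => γ (s - d)) (a + d) (b + d) = curveLength γ a b := by
  have h := (measurePreserving_sub_right (volume : Measure ℝ) d).setLIntegral_comp_preimage_emb
    (MeasurableEquiv.subRight d).measurableEmbedding (fun s => ENNReal.ofReal (speed γ s)) (Ioo a b)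
  simp only [curveLength, speed_translate]
  rw [← h]
  simp

theorem deriv_ite_left {f g : ℝ → ℝ} {c s : ℝ} (hs : s < c) :
    deriv (fun r => if r ≤ c then f r else g r) s = deriv f s := by
  refine Filter.EventuallyEq.deriv_eq ?_
  filter_upwards [Iio_mem_nhds hs] with r hr
  exact if_pos (le_of_lt hr)

theorem deriv_ite_right {f g : ℝ → ℝ} {c s : ℝ} (hs : c < s) :
    deriv (fun r => if r ≤ c then f r else g r) s = deriv g s := by
  refine Filter.EventuallyEq.deriv_eq ?_
  filter_upwards [Ioi_mem_nhds hs] with r hr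
  exact if_neg (not_le.2 hr)

/-- The concatenation of two curves at time `c`. -/
def glue (γ η : ℝ → Jet k) (c : ℝ) (s : ℝ) : Jet k :=
  ⟨if s ≤ c then (γ s).x else (η s).x, fun j => if s ≤ c then (γ s).u j else (η s).u j⟩

open MeasureTheory Set in
theorem IsHorizontal.glue {γ η : ℝ → Jet k} {a c b : ℝ} (hac : a ≤ c) (hcb : c ≤ b)
    (hγ : IsHorizontal γ a c) (hη : IsHorizontal η c b) (h : γ c = η c) :
    IsHorizontal (Jet.glue γ η c) a b where
  ac_x := ac_glue hac hcb hγ.ac_x hη.ac_x (by rw [h])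
  ac_u j := ac_glue hac hcb (hγ.ac_u j) (hη.ac_u j) (by rw [h])
  contact := by
    filter_upwards [hγ.contact, hη.contact, Measure.ae_ne volume c] with s h1 h2 hsc hs j
    simp only [Jet.glue]
    rcases lt_or_gt_of_ne hsc with hlt | hgt
    · rw [deriv_ite_left hlt, deriv_ite_left hlt, if_pos hlt.le, h1 ⟨hs.1, hlt⟩ j]
    · rw [deriv_ite_right hgt, deriv_ite_right hgt, if_neg (not_le.2 hgt), h2 ⟨hgt, hs.2⟩ j]

open MeasureTheory Set in
theorem curveLength_glue_le (γ η : ℝ → Jet k) (a c b : ℝ) :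
    curveLength (glue γ η c) a b ≤ curveLength γ a c + curveLength η c b := by
  have h0 : Ioo a b ⊆ Ioo a c ∪ Ioo c b ∪ {c} := by
    intro s hs
    rcases lt_trichotomy s c with h | h | h
    · exact Or.inl (Or.inl ⟨hs.1, h⟩)
    · exact Or.inr h
    · exact Or.inl (Or.inr ⟨h, hs.2⟩)
  have h1 : ∫⁻ s in Ioo a c, ENNReal.ofReal (speed (glue γ η c) s) = curveLength γ a c := by
    refine setLIntegral_congr_fun measurableSet_Ioo fun s hs => ?_
    simp only [speed, glue]
    rw [deriv_ite_left hs.2, deriv_ite_left hs.2]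
  have h2 : ∫⁻ s in Ioo c b, ENNReal.ofReal (speed (glue γ η c) s) = curveLength η c b := by
    refine setLIntegral_congr_fun measurableSet_Ioo fun s hs => ?_
    simp only [speed, glue]
    rw [deriv_ite_right hs.1, deriv_ite_right hs.1]
  calc curveLength (glue γ η c) a b
      ≤ ∫⁻ s in Ioo a c ∪ Ioo c b ∪ {c}, ENNReal.ofReal (speed (glue γ η c) s) :=
        lintegral_mono_set h0
    _ ≤ (∫⁻ s in Ioo a c ∪ Ioo c b, ENNReal.ofReal (speed (glue γ η c) s)) +
          ∫⁻ s in {c}, ENNReal.ofReal (speed (glue γ η c) s) := lintegral_union_le _ _ _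
    _ ≤ ((∫⁻ s in Ioo a c, ENNReal.ofReal (speed (glue γ η c) s)) +
          ∫⁻ s in Ioo c b, ENNReal.ofReal (speed (glue γ η c) s)) + 0 := by
        gcongr
        · exact lintegral_union_le _ _ _
        · simp
    _ = curveLength γ a c + curveLength η c b := by rw [h1, h2, add_zero]

theorem ccDist_triangle (p q r : Jet k) : ccDist p r ≤ ccDist p q + ccDist q r := by
  refine ENNReal.le_of_forall_pos_le_add fun ε hε hfin => ?_
  have hp : ccDist p q ≠ ⊤ := (lt_of_le_of_lt le_self_add hfin).ne
  have hq : ccDist q r ≠ ⊤ := (lt_of_le_of_lt le_add_self hfin).ne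
  have hε2 : ((ε : ℝ≥0∞) / 2) ≠ 0 := by simpa using hε.ne'
  obtain ⟨L, ⟨γ, a, c, hac, hγ, ha, hc, rfl⟩, hL⟩ :=
    sInf_lt_iff.1 (ENNReal.lt_add_right hp hε2)
  obtain ⟨M, ⟨η, c', b, hcb, hη, hc', hb, rfl⟩, hM⟩ :=
    sInf_lt_iff.1 (ENNReal.lt_add_right hq hε2)
  have e1 : c' + (c - c') = c := by ring
  have hη2 := hη.translate hcb (c - c')
  have hlen := curveLength_translate η c' b (c - c')
  rw [e1] at hη2 hlen
  have hcb2 : c ≤ b + (c - c') := by linarith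
  have hjoin : γ c = η (c - (c - c')) := by rw [sub_sub_cancel, hc, hc']
  have hend : glue γ (fun s => η (s - (c - c'))) c (b + (c - c')) = r := by
    by_cases h : b + (c - c') ≤ c
    · have hbc : b = c' := by linarith
      have h2 : glue γ (fun s => η (s - (c - c'))) c (b + (c - c')) = γ (b + (c - c')) := by
        simp [glue, h]
      rw [h2, hbc, e1, hc, ← hc', ← hbc, hb]
    · have h2 : glue γ (fun s => η (s - (c - c'))) c (b + (c - c')) = η b := by
        simp only [glue, h, if_false, add_sub_cancel_right]
      rw [h2, hb]
  have hstart : glue γ (fun s => η (s - (c - c'))) c a = p := by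
    simp [glue, hac, ha]
  calc ccDist p r ≤ curveLength (glue γ (fun s => η (s - (c - c'))) c) a (b + (c - c')) :=
        sInf_le ⟨_, a, b + (c - c'), hac.trans hcb2, hγ.glue hac hcb2 hη2 hjoin, hstart, hend, rfl⟩
    _ ≤ curveLength γ a c + curveLength η c' b := by
        rw [← hlen]; exact curveLength_glue_le _ _ _ _ _
    _ ≤ (ccDist p q + ε / 2) + (ccDist q r + ε / 2) := add_le_add hL.le hM.le
    _ = ccDist p q + ccDist q r + ε := by
        rw [add_add_add_comm, ENNReal.add_halves]

open MeasureTheory Set in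
theorem abs_sub_le_of_deriv_le {γ : ℝ → Jet k} {g : ℝ → ℝ} {a b K ε : ℝ} (hK : 0 ≤ K)
    (hε : 0 ≤ ε) (hg : AbsolutelyContinuousOnInterval g a b)
    (hd : ∀ᵐ s : ℝ, s ∈ Ioo a b → |deriv g s| ≤ K * speed γ s)
    (hL : curveLength γ a b ≤ ENNReal.ofReal ε) {s : ℝ} (hs : s ∈ Icc a b) :
    |g s - g a| ≤ K * ε := by
  have hab : a ≤ b := hs.1.trans hs.2
  rw [← eq_integral_of_ac hg (s := a) (t := s) (by simp) (by rwa [uIcc_of_le hab]),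
    ← ENNReal.ofReal_le_ofReal_iff (by positivity), ← Real.norm_eq_abs,
    intervalIntegral.integral_of_le hs.1, ofReal_norm]
  calc ‖∫ r in Ioc a s, deriv g r‖ₑ ≤ ∫⁻ r in Ioc a s, ‖deriv g r‖ₑ :=
        enorm_integral_le_lintegral_enorm _
    _ ≤ ∫⁻ r in Ioc a b, ‖deriv g r‖ₑ := lintegral_mono_set (Ioc_subset_Ioc_right hs.2)
    _ = ∫⁻ r in Ioo a b, ‖deriv g r‖ₑ := by rw [restrict_Ioo_eq_restrict_Ioc]
    _ ≤ ∫⁻ r in Ioo a b, ENNReal.ofReal K * ENNReal.ofReal (speed γ r) := by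
        refine setLIntegral_mono_ae' measurableSet_Ioo ?_
        filter_upwards [hd] with r hr hr'
        rw [← ENNReal.ofReal_mul hK, ← ofReal_norm, Real.norm_eq_abs]
        exact ENNReal.ofReal_le_ofReal (hr hr')
    _ = ENNReal.ofReal K * curveLength γ a b := by
        rw [lintegral_const_mul' _ _ ENNReal.ofReal_ne_top, curveLength]
    _ ≤ ENNReal.ofReal K * ENNReal.ofReal ε := by gcongr
    _ = ENNReal.ofReal (K * ε) := (ENNReal.ofReal_mul hK).symm

theorem abs_deriv_x_le_speed (γ : ℝ → Jet k) (s : ℝ) :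
    |deriv (fun r => (γ r).x) s| ≤ speed γ s :=
  Real.abs_le_sqrt (le_add_of_nonneg_right (sq_nonneg _))

theorem abs_deriv_last_le_speed (γ : ℝ → Jet k) (s : ℝ) :
    |deriv (fun r => (γ r).u (Fin.last k)) s| ≤ speed γ s :=
  Real.abs_le_sqrt (le_add_of_nonneg_left (sq_nonneg _))

open MeasureTheory Set in
theorem abs_u_sub_le (p : Jet k) (j : Fin (k + 1)) :
    ∃ C : ℝ, 0 ≤ C ∧ ∀ (γ : ℝ → Jet k) (a b ε : ℝ), IsHorizontal γ a b → γ a = p → 0 ≤ ε →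
      ε ≤ 1 → curveLength γ a b ≤ ENNReal.ofReal ε →
      ∀ s ∈ Icc a b, |(γ s).u j - p.u j| ≤ C * ε := by
  induction j using Fin.reverseInduction with
  | last =>
    refine ⟨1, zero_le_one, fun γ a b ε hγ ha hε _ hL s hs => ?_⟩
    rw [← ha]
    exact abs_sub_le_of_deriv_le (g := fun r => (γ r).u (Fin.last k)) zero_le_one hε
      (hγ.ac_u _) (ae_of_all _ fun r _ => by
        rw [one_mul]; exact abs_deriv_last_le_speed γ r) hL hs
  | cast j ih =>
    obtain ⟨C, hC, H⟩ := ih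
    refine ⟨|p.u j.succ| + C, by positivity, fun γ a b ε hγ ha hε hε1 hL s hs => ?_⟩
    have hb := H γ a b ε hγ ha hε hε1 hL
    rw [← ha]
    refine abs_sub_le_of_deriv_le (g := fun r => (γ r).u j.castSucc) (by positivity) hε
      (hγ.ac_u _) ?_ hL hs
    filter_upwards [hγ.contact] with r hr hr'
    rw [hr hr' j, abs_mul]
    have h1 := hb r (Ioo_subset_Icc_self hr')
    have h2 : |(γ r).u j.succ| ≤ |p.u j.succ| + C := by
      have h3 := abs_sub_abs_le_abs_sub ((γ r).u j.succ) (p.u j.succ)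
      have h4 : C * ε ≤ C := mul_le_of_le_one_right hC hε1
      linarith
    rw [ha]
    exact mul_le_mul h2 (abs_deriv_x_le_speed γ r) (abs_nonneg _) (by positivity)

theorem eq_of_forall_abs_le {y z C : ℝ} (h : ∀ ε : ℝ, 0 < ε → ε ≤ 1 → |y - z| ≤ C * ε) :
    y = z := by
  have h1 : Filter.Tendsto (fun ε : ℝ => C * ε) (nhdsWithin 0 (Set.Ioi 0)) (nhds 0) := by
    have : Filter.Tendsto (fun ε : ℝ => C * ε) (nhds 0) (nhds (C * 0)) :=
      (continuous_const.mul continuous_id).tendsto 0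
    rw [mul_zero] at this
    exact this.mono_left nhdsWithin_le_nhds
  have h2 : |y - z| ≤ 0 := by
    refine ge_of_tendsto h1 ?_
    filter_upwards [Ioc_mem_nhdsGT (zero_lt_one' ℝ)] with ε hε
    exact h ε hε.1 hε.2
  exact sub_eq_zero.1 (abs_nonpos_iff.1 h2)

theorem eq_of_ccDist_eq_zero {p q : Jet k} (h : ccDist p q = 0) : p = q := by
  have key : ∀ ε : ℝ, 0 < ε → ∃ (γ : ℝ → Jet k) (a b : ℝ), a ≤ b ∧ IsHorizontal γ a b ∧ γ a = p ∧
      γ b = q ∧ curveLength γ a b ≤ ENNReal.ofReal ε := by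
    intro ε hε
    have h1 : ccDist p q < ENNReal.ofReal ε := by rw [h]; exact ENNReal.ofReal_pos.2 hε
    obtain ⟨L, ⟨γ, a, b, hab, hγ, ha, hb, rfl⟩, hL⟩ := sInf_lt_iff.1 h1
    exact ⟨γ, a, b, hab, hγ, ha, hb, hL.le⟩
  ext j
  · symm
    refine eq_of_forall_abs_le (C := 1) fun ε hε _ => ?_
    obtain ⟨γ, a, b, hab, hγ, ha, hb, hL⟩ := key ε hε
    rw [← ha, ← hb]
    exact abs_sub_le_of_deriv_le (g := fun r => (γ r).x) zero_le_one hε.le hγ.ac_x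
      (Filter.Eventually.of_forall fun r _ => by
        rw [one_mul]; exact abs_deriv_x_le_speed γ r) hL ⟨hab, le_rfl⟩
  · symm
    obtain ⟨C, _, H⟩ := abs_u_sub_le p j
    refine eq_of_forall_abs_le (C := C) fun ε hε hε1 => ?_
    obtain ⟨γ, a, b, hab, hγ, ha, hb, hL⟩ := key ε hε
    rw [← hb]
    exact H γ a b ε hγ ha hε.le hε1 hL b ⟨hab, le_rfl⟩

/-- The jet space with its Carnot–Carathéodory metric. -/
instance : EMetricSpace (Jet k) where
  edist := ccDist
  edist_self := ccDist_self
  edist_comm p q := le_antisymm (ccDist_comm_le p q) (ccDist_comm_le q p)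
  edist_triangle := ccDist_triangle
  eq_of_edist_eq_zero := eq_of_ccDist_eq_zero

/-! ### The horizontal and vertical mappings -/

/-- The `k`-jet `j^k_y(f) = (y, f^{(k)}(y), …, f'(y), f(y))` of `f` at `y`. -/
def jetOf (k : ℕ) (f : ℝ → ℝ) (y : ℝ) : Jet k :=
  ⟨y, fun j => iteratedDeriv j f y⟩

/-- The horizontal mapping `J_{f,t}(x, u_k, …, u_0) = j^k_{x-t}(f)`. -/
def horizontalMap (f : ℝ → ℝ) (t : ℝ) (p : Jet k) : Jet k :=
  jetOf k f (p.x - t)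

/-- The vertical mapping `V_{f,t}(x, u_k, …, u_0) = (x, u_k, …, u_0) ⊙ j^k_{x-t}(f)⁻¹`. -/
def verticalMap (f : ℝ → ℝ) (t : ℝ) (p : Jet k) : Jet k :=
  p * (jetOf k f (p.x - t))⁻¹

end Jet

end

/-!
The vertical map sends everything into the fibre over `t`, and the horizontal map sends everything
into the curve `y ↦ j^k_y(f)`. Moreover `b ⊙ j^k_y(f)`, with `b` in the fibre over `t`, has
horizontal part `j^k_y(f)` and vertical part `b`. So for nonempty `A ⊆ ℝ` and `B` in the fibre over
`t`, the set of all `b ⊙ j^k_a(f)` has images `j^k(f)(A)` and `B`, and the two dimensions can be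
prescribed independently once `A` and `B` exist.

The curve `j^k(f)` is horizontal and smooth, hence locally Lipschitz, and the base point is a
Lipschitz left inverse; so it preserves dimensions (`Jet.dimH_image_jetOf`).

On the fibre over `t` the distance between `(t, u)` and `(t, v)` is comparable to `max_s |u_s -
v_s| ^ (1 / (k + 1 - s))` (`Jet.exists_isBoxEmbedding_fibre`). By left invariance
(`Jet.edist_mul_left`) this is an estimate for the distance from the identity to `(0, w)`. The
lower bound comes from integrating the contact equations (`Jet.abs_u_le_pow`). For the upper bound,
conjugating the direction `∂_{u_k}` by the flow of `X` shows that `c` times the moment vector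
`(y^{k-s} / (k-s)!)_s` is at distance at most `|c| + 2 |y|` from the identity
(`Jet.edist_one_moment_le`), and by invertibility of a Vandermonde matrix the moment vectors span
the fibre (`Jet.exists_moment_coeff`).

A metric space with weighted box coordinates of weights `w i` (`IsBoxEmbedding`) has dimension at
most `Q = ∑ w i`, by covering with boxes, and it contains sets of every dimension `β` with `0 ≤ β ≤
Q` (`IsBoxEmbedding.exists_dimH_eq`): for `0 < β < Q`, the Cantor set of `2 ^ Q` pieces contracted
by `ρ = 2 ^ (-Q / β)`. Its dimension is bounded above by counting pieces and below by mapping it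
onto `[0, 1]`, Hölder with exponent `β`, through base-`2 ^ Q` expansions. This serves the fibre,
with `Q = (k + 1)(k + 2) / 2`, and the real line, with `Q = 1`.
-/

/-! ### Hausdorff dimension of coded sets -/

section CodedSets

open MeasureTheory Set Filter Topology
open scoped NNReal

/-- Covering bound for the dimension: `code m` splits the image of `Φ` into at most `N ^ m` pieces,
each of diameter at most `C * ρ ^ m`. -/
theorem dimH_range_le_of_codes {X Y : Type*} [EMetricSpace X] {Φ : Y → X} {N : ℕ} {ρ C : ℝ}
    {d : ℝ≥0} (hρ0 : 0 < ρ) (hρ1 : ρ < 1) (hC : 0 ≤ C) (hN : N * ρ ^ (d : ℝ) ≤ 1)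
    {ι : ℕ → Type*} [∀ m, Fintype (ι m)] (hcard : ∀ m, Fintype.card (ι m) ≤ N ^ m)
    (code : ∀ m, Y → ι m)
    (hcode : ∀ m a b, code m a = code m b → edist (Φ a) (Φ b) ≤ ENNReal.ofReal (C * ρ ^ m)) :
    dimH (range Φ) ≤ d := by
  borelize X
  have hdiam : ∀ m i, Metric.ediam (Φ '' {a | code m a = i}) ≤ ENNReal.ofReal (C * ρ ^ m) := by
    intro m i
    refine Metric.ediam_le ?_
    rintro _ ⟨a, rfl, rfl⟩ _ ⟨b, hb, rfl⟩
    exact hcode m a b hb.symm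
  have hr : Tendsto (fun m : ℕ => ENNReal.ofReal (C * ρ ^ m)) atTop (𝓝 0) := by
    rw [← ENNReal.ofReal_zero]
    refine ENNReal.tendsto_ofReal ?_
    simpa using (tendsto_pow_atTop_nhds_zero_of_lt_one hρ0.le hρ1).const_mul C
  have h1 := Measure.hausdorffMeasure_le_liminf_sum (d : ℝ) (range Φ) (l := atTop) _ hr
    (fun m i => Φ '' {a | code m a = i}) (Eventually.of_forall hdiam)
    (Eventually.of_forall fun m => by
      rintro _ ⟨a, rfl⟩
      exact mem_iUnion.2 ⟨code m a, a, rfl, rfl⟩)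
  have h2 : ∀ m, ∑ i, Metric.ediam (Φ '' {a | code m a = i}) ^ (d : ℝ) ≤
      ENNReal.ofReal (C ^ (d : ℝ)) := by
    intro m
    calc ∑ i, Metric.ediam (Φ '' {a | code m a = i}) ^ (d : ℝ)
        ≤ ∑ i : ι m, ENNReal.ofReal ((C * ρ ^ m) ^ (d : ℝ)) := by
          refine Finset.sum_le_sum fun i _ => ?_
          rw [← ENNReal.ofReal_rpow_of_nonneg (by positivity) d.coe_nonneg]
          exact ENNReal.rpow_le_rpow (hdiam m i) d.coe_nonneg
      _ = ENNReal.ofReal (Fintype.card (ι m) * (C * ρ ^ m) ^ (d : ℝ)) := by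
          rw [Finset.sum_const, Finset.card_univ, nsmul_eq_mul,
            ENNReal.ofReal_mul (Nat.cast_nonneg _), ENNReal.ofReal_natCast]
      _ ≤ ENNReal.ofReal (C ^ (d : ℝ)) := by
          refine ENNReal.ofReal_le_ofReal ?_
          have h3 : ((Fintype.card (ι m) : ℕ) : ℝ) ≤ (N : ℝ) ^ m := by exact_mod_cast hcard m
          have h4 : (ρ ^ m) ^ (d : ℝ) = (ρ ^ (d : ℝ)) ^ m := by
            rw [← Real.rpow_natCast, ← Real.rpow_natCast, ← Real.rpow_mul hρ0.le, mul_comm,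
              Real.rpow_mul hρ0.le]
          rw [Real.mul_rpow hC (by positivity), h4]
          calc _ ≤ (N : ℝ) ^ m * (C ^ (d : ℝ) * (ρ ^ (d : ℝ)) ^ m) := by gcongr
            _ = C ^ (d : ℝ) * (N * ρ ^ (d : ℝ)) ^ m := by rw [mul_pow]; ring
            _ ≤ C ^ (d : ℝ) * 1 := by
                gcongr
                exact pow_le_one₀ (by positivity) hN
            _ = _ := mul_one _
  have h3 : μH[d] (range Φ) ≤ ENNReal.ofReal (C ^ (d : ℝ)) :=
    h1.trans ((liminf_le_liminf (Eventually.of_forall h2)).trans_eq (liminf_const _))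
  exact dimH_le_of_hausdorffMeasure_ne_top (ne_top_of_le_ne_top ENNReal.ofReal_ne_top h3)

/-- If sequences over `N` digits that first differ at place `m` are sent to points at distance at
least `c * ρ ^ m`, then reading the digits in base `N` is a map from the image onto `[0, 1]` that is
Hölder with exponent `d` as soon as `1 ≤ N * ρ ^ d`. This bounds the dimension from below without a
mass distribution. -/
theorem le_dimH_range_of_separated {X : Type*} [EMetricSpace X] {N : ℕ} (hN : 1 < N)
    {Φ : (ℕ → Fin N) → X} {ρ c : ℝ} {d : ℝ≥0} (hd : 0 < d) (hρ : 0 < ρ) (hc : 0 < c)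
    (hNρ : 1 ≤ N * ρ ^ (d : ℝ))
    (hsep : ∀ a b m, (∀ i < m, a i = b i) → a m ≠ b m →
      ENNReal.ofReal (c * ρ ^ m) ≤ edist (Φ a) (Φ b)) :
    d ≤ dimH (range Φ) := by
  have hfirst : ∀ a b : ℕ → Fin N, a ≠ b → ∃ m, (∀ i < m, a i = b i) ∧ a m ≠ b m := by
    intro a b hab
    have hex := Function.ne_iff.1 hab
    classical
    exact ⟨Nat.find hex, fun i hi => not_not.1 (Nat.find_min hex hi), Nat.find_spec hex⟩
  have hinj : Function.Injective Φ := by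
    intro a b hab
    by_contra hne
    obtain ⟨m, h1, h2⟩ := hfirst a b hne
    have := hsep a b m h1 h2
    rw [hab, edist_self, nonpos_iff_eq_zero, ENNReal.ofReal_eq_zero] at this
    exact absurd this (not_le.2 (by positivity))
  have : Nonempty (ℕ → Fin N) := ⟨fun _ => ⟨0, by omega⟩⟩
  set g : X → ℝ := fun x => Real.ofDigits (Function.invFun Φ x) with hg
  have hgΦ : ∀ a, g (Φ a) = Real.ofDigits a := fun a => by
    simp only [hg, Function.leftInverse_invFun hinj a]
  have hholder : HolderOnWith (Real.toNNReal ((c ^ (d : ℝ))⁻¹)) d g (range Φ) := by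
    rintro _ ⟨a, rfl⟩ _ ⟨b, rfl⟩
    rw [hgΦ, hgΦ]
    by_cases hab : a = b
    · simp [hab]
    obtain ⟨m, h1, h2⟩ := hfirst a b hab
    have hpos : 0 < c ^ (d : ℝ) := by positivity
    have h4 : (ρ ^ m) ^ (d : ℝ) = (ρ ^ (d : ℝ)) ^ m := by
      rw [← Real.rpow_natCast, ← Real.rpow_natCast, ← Real.rpow_mul hρ.le, mul_comm,
        Real.rpow_mul hρ.le]
    have h3 : ((N : ℝ) ^ m)⁻¹ ≤ (c ^ (d : ℝ))⁻¹ * (c * ρ ^ m) ^ (d : ℝ) := by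
      rw [Real.mul_rpow hc.le (by positivity), inv_mul_cancel_left₀ hpos.ne', h4,
        inv_le_iff_one_le_mul₀ (by positivity), ← mul_pow, mul_comm]
      exact one_le_pow₀ hNρ
    calc edist (Real.ofDigits a) (Real.ofDigits b)
        = ENNReal.ofReal |Real.ofDigits a - Real.ofDigits b| := by
          rw [edist_dist, Real.dist_eq]
      _ ≤ ENNReal.ofReal ((c ^ (d : ℝ))⁻¹ * (c * ρ ^ m) ^ (d : ℝ)) :=
          ENNReal.ofReal_le_ofReal ((Real.abs_ofDigits_sub_ofDigits_le h1).trans h3)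
      _ = (Real.toNNReal ((c ^ (d : ℝ))⁻¹) : ℝ≥0∞) * ENNReal.ofReal (c * ρ ^ m) ^ (d : ℝ) := by
          rw [ENNReal.ofReal_mul (by positivity),
            ENNReal.ofReal_rpow_of_nonneg (by positivity) d.coe_nonneg]
          rfl
      _ ≤ _ := by
          gcongr
          exact hsep a b m h1 h2
  have h5 := hholder.dimH_image_le hd
  have h6 : (1 : ℝ≥0∞) ≤ dimH (g '' range Φ) := by
    have h7 : dimH (Icc (0 : ℝ) 1) = 1 := by
      rw [Real.dimH_of_nonempty_interior (by simp)]
      simp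
    rw [← h7]
    refine dimH_mono fun y hy => ?_
    obtain ⟨a, -, ha⟩ := Real.ofDigits_SurjOn hN hy
    exact ⟨Φ a, mem_range_self a, by rw [hgΦ, ha]⟩
  have h8 := h6.trans h5
  rwa [ENNReal.le_div_iff_mul_le (Or.inl (by simpa using hd.ne')) (Or.inl (by simp)),
    one_mul] at h8

/-! ### Series with bounded coefficients -/

theorem summable_mul_pow_of_bounded {ε : ℕ → ℝ} {M σ : ℝ} (hσ0 : 0 ≤ σ) (hσ1 : σ < 1)
    (hM : ∀ n, |ε n| ≤ M) : Summable fun n => ε n * σ ^ n := by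
  refine Summable.of_norm_bounded (g := fun n => M * σ ^ n)
    ((summable_geometric_of_lt_one hσ0 hσ1).mul_left M) fun n => ?_
  rw [norm_mul, Real.norm_eq_abs, Real.norm_of_nonneg (by positivity)]
  gcongr
  exact hM n

theorem abs_tsum_mul_pow_le {ε : ℕ → ℝ} {M σ : ℝ} (hσ0 : 0 ≤ σ) (hσ1 : σ < 1)
    (hM : ∀ n, |ε n| ≤ M) {m : ℕ} (h0 : ∀ n < m, ε n = 0) :
    |∑' n, ε n * σ ^ n| ≤ M / (1 - σ) * σ ^ m := by
  rw [← (summable_mul_pow_of_bounded hσ0 hσ1 hM).sum_add_tsum_nat_add m,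
    Finset.sum_eq_zero fun n hn => by rw [h0 n (Finset.mem_range.1 hn), zero_mul], zero_add]
  have h1 : HasSum (fun n => M * σ ^ m * σ ^ n) (M / (1 - σ) * σ ^ m) := by
    have := (hasSum_geometric_of_lt_one hσ0 hσ1).mul_left (M * σ ^ m)
    convert! this using 1
    ring
  rw [← Real.norm_eq_abs]
  refine tsum_of_norm_bounded h1 fun n => ?_
  rw [norm_mul, Real.norm_eq_abs, Real.norm_of_nonneg (by positivity), pow_add, mul_assoc,
    mul_comm (σ ^ n)]
  gcongr
  exact hM _

/-- The first nonzero term dominates the tail when `M * σ < 1 - σ`; otherwise the bound is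
trivial. -/
theorem le_abs_tsum_mul_pow {ε : ℕ → ℝ} {M σ : ℝ} (hσ0 : 0 ≤ σ) (hσ1 : σ < 1)
    (hM : ∀ n, |ε n| ≤ M) {m : ℕ} (h0 : ∀ n < m, ε n = 0) (hm : 1 ≤ |ε m|) :
    (1 - M * σ / (1 - σ)) * σ ^ m ≤ |∑' n, ε n * σ ^ n| := by
  have hs := summable_mul_pow_of_bounded hσ0 hσ1 hM
  set ε' : ℕ → ℝ := fun n => if n = m then 0 else ε n with hε'
  have hM0 : 0 ≤ M := (abs_nonneg _).trans (hM 0)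
  have hM' : ∀ n, |ε' n| ≤ M := fun n => by
    by_cases h : n = m
    · simpa [hε', h] using hM0
    · simpa [hε', h] using hM n
  have h0' : ∀ n < m + 1, ε' n = 0 := fun n hn => by
    by_cases h : n = m
    · simp [hε', h]
    · simpa [hε', h] using h0 n (by omega)
  have h1 := abs_tsum_mul_pow_le hσ0 hσ1 hM' h0'
  have h2 : ∑' n, ε n * σ ^ n = ε m * σ ^ m + ∑' n, ε' n * σ ^ n := by
    rw [hs.tsum_eq_add_tsum_ite m]
    congr 1
    refine tsum_congr fun n => ?_
    by_cases h : n = m <;> simp [hε', h]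
  have h3 : σ ^ m ≤ |ε m * σ ^ m| := by
    rw [abs_mul, abs_of_nonneg (pow_nonneg hσ0 m)]
    exact le_mul_of_one_le_left (by positivity) hm
  have h4 : |ε m * σ ^ m| ≤ |∑' n, ε n * σ ^ n| + |∑' n, ε' n * σ ^ n| := by
    rw [h2]
    simpa using abs_sub (ε m * σ ^ m + ∑' n, ε' n * σ ^ n) (∑' n, ε' n * σ ^ n)
  have h5 : M / (1 - σ) * σ ^ (m + 1) = M * σ / (1 - σ) * σ ^ m := by rw [pow_succ]; ring
  rw [h5] at h1
  linarith

end CodedSets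

/-! ### Weighted box coordinates and self-similar Cantor sets -/

section BoxEmbedding

open Set Filter Topology
open scoped NNReal

/-- Weighted box coordinates on a metric space: the distance of `e u` and `e v` is comparable to
`max_i |u i - v i| ^ (1 / w i)`. The two comparisons are expressed through boxes of side lengths
`r ^ w i`, which avoids roots; the lower one has constant `1`. -/
structure IsBoxEmbedding {ι X : Type*} [EMetricSpace X] (w : ι → ℕ) (C : ℝ)
    (e : (ι → ℝ) → X) : Prop where
  nonneg : 0 ≤ C
  edist_le : ∀ u v : ι → ℝ, ∀ r : ℝ, 0 < r → (∀ i, |u i - v i| ≤ r ^ w i) →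
    edist (e u) (e v) ≤ ENNReal.ofReal (C * r)
  abs_sub_le : ∀ u v : ι → ℝ, ∀ r : ℝ, 0 < r → edist (e u) (e v) ≤ ENNReal.ofReal r →
    ∀ i, |u i - v i| ≤ r ^ w i

/-- The point of `ι → ℝ` whose `i`-th coordinate has the expansion `∑ₙ (a n)ᵢ (ρ ^ w i) ^ n`, with
digits `(a n)ᵢ < 2 ^ w i`. -/
noncomputable def cantorPoint {ι : Type*} (w : ι → ℕ) (ρ : ℝ) (a : ℕ → ∀ i, Fin (2 ^ w i))
    (i : ι) : ℝ :=
  ∑' n, ((a n i : ℕ) : ℝ) * (ρ ^ w i) ^ n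

variable {ι X : Type*} {w : ι → ℕ} {ρ : ℝ} {a b : ℕ → ∀ i, Fin (2 ^ w i)}

theorem abs_digit_sub_le (n : ℕ) (i : ι) :
    |((a n i : ℕ) : ℝ) - ((b n i : ℕ) : ℝ)| ≤ 2 ^ w i - 1 := by
  have h : ∀ c : Fin (2 ^ w i), ((c : ℕ) : ℝ) ≤ 2 ^ w i - 1 := fun c => by
    have h1 : (c : ℕ) + 1 ≤ 2 ^ w i := c.2
    have h2 : ((c : ℕ) : ℝ) + 1 ≤ 2 ^ w i := by exact_mod_cast h1
    linarith
  have h1 := h (a n i)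
  have h2 := h (b n i)
  have h3 : (0 : ℝ) ≤ (a n i : ℕ) := Nat.cast_nonneg _
  have h4 : (0 : ℝ) ≤ (b n i : ℕ) := Nat.cast_nonneg _
  rw [abs_le]
  constructor <;> linarith

theorem cantorPoint_sub (hρ0 : 0 ≤ ρ) (hρ1 : ρ < 1) (hw : ∀ i, 1 ≤ w i) (i : ι) :
    cantorPoint w ρ a i - cantorPoint w ρ b i =
      ∑' n, (((a n i : ℕ) : ℝ) - ((b n i : ℕ) : ℝ)) * (ρ ^ w i) ^ n := by
  have hs : ∀ c : ℕ → ∀ i, Fin (2 ^ w i),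
      Summable fun n => ((c n i : ℕ) : ℝ) * (ρ ^ w i) ^ n := fun c => by
    refine summable_mul_pow_of_bounded (M := 2 ^ w i) (by positivity)
      (pow_lt_one₀ hρ0 hρ1 (by have := hw i; omega)) fun n => ?_
    rw [abs_of_nonneg (Nat.cast_nonneg _)]
    exact_mod_cast (c n i).2.le
  rw [cantorPoint, cantorPoint, ← (hs a).tsum_sub (hs b)]
  exact tsum_congr fun n => by ring

theorem abs_cantorPoint_sub_le (hρ0 : 0 ≤ ρ) (hρ1 : ρ < 1 / 2) (hw : ∀ i, 1 ≤ w i) {m : ℕ}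
    (h : ∀ n < m, a n = b n) (i : ι) :
    |cantorPoint w ρ a i - cantorPoint w ρ b i| ≤ (4 * ρ ^ m) ^ w i := by
  have hwi := hw i
  have h1 : ρ ^ w i ≤ 1 / 2 := (pow_le_of_le_one hρ0 (by linarith) (by omega)).trans hρ1.le
  have h0 : 0 ≤ ρ ^ w i := pow_nonneg hρ0 _
  rw [cantorPoint_sub hρ0 (by linarith) hw]
  have hM : ∀ n, |((a n i : ℕ) : ℝ) - ((b n i : ℕ) : ℝ)| ≤ 2 ^ w i - 1 :=
    fun n => abs_digit_sub_le n i
  have hz : ∀ n < m, ((a n i : ℕ) : ℝ) - ((b n i : ℕ) : ℝ) = 0 := fun n hn => by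
    rw [h n hn, sub_self]
  refine (abs_tsum_mul_pow_le h0 (by linarith) hM hz).trans ?_
  rw [mul_pow, ← pow_mul, ← pow_mul, mul_comm m]
  gcongr
  have h2 : (2 : ℝ) ≤ 2 ^ w i := le_self_pow₀ (by norm_num) (by omega)
  have h3 : (4 : ℝ) ^ w i = 2 ^ w i * 2 ^ w i := by rw [← mul_pow]; norm_num
  rw [div_le_iff₀ (by linarith), h3]
  nlinarith

theorem le_abs_cantorPoint_sub (hρ0 : 0 ≤ ρ) (hρ1 : ρ < 1 / 2) (hw : ∀ i, 1 ≤ w i) {m : ℕ}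
    (h : ∀ n < m, a n = b n) {i : ι} (hi : a m i ≠ b m i) :
    (1 - 2 * ρ) * (ρ ^ m) ^ w i ≤ |cantorPoint w ρ a i - cantorPoint w ρ b i| := by
  have hwi := hw i
  have h1 : ρ ^ w i < 1 :=
    (pow_le_of_le_one hρ0 (by linarith) (by omega)).trans_lt (by linarith)
  have h0 : 0 ≤ ρ ^ w i := pow_nonneg hρ0 _
  have hdig : (1 : ℝ) ≤ |((a m i : ℕ) : ℝ) - ((b m i : ℕ) : ℝ)| := by
    have h2 : ((a m i : ℕ) : ℤ) - ((b m i : ℕ) : ℤ) ≠ 0 := by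
      have := Fin.val_ne_of_ne hi
      omega
    exact_mod_cast Int.one_le_abs h2
  rw [cantorPoint_sub hρ0 (by linarith) hw]
  have hM : ∀ n, |((a n i : ℕ) : ℝ) - ((b n i : ℕ) : ℝ)| ≤ 2 ^ w i - 1 :=
    fun n => abs_digit_sub_le n i
  have hz : ∀ n < m, ((a n i : ℕ) : ℝ) - ((b n i : ℕ) : ℝ) = 0 := fun n hn => by
    rw [h n hn, sub_self]
  refine le_trans ?_ (le_abs_tsum_mul_pow h0 h1 hM hz hdig)
  rw [← pow_mul, ← pow_mul, mul_comm m]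
  gcongr
  have h3 : 2 ^ w i * ρ ^ w i ≤ 2 * ρ := by
    rw [← mul_pow]
    exact pow_le_of_le_one (by positivity) (by linarith) (by omega)
  rw [div_le_iff₀ (by linarith)]
  nlinarith [mul_nonneg (by linarith : 0 ≤ 1 - 2 * ρ) h0]

variable [Fintype ι] [EMetricSpace X] {C : ℝ} {e : (ι → ℝ) → X}

theorem card_digits [DecidableEq ι] (w : ι → ℕ) :
    Fintype.card (∀ i, Fin (2 ^ w i)) = 2 ^ ∑ i, w i := by
  simp [Fintype.card_pi, Finset.prod_pow_eq_pow_sum]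

/-- The points `cantorPoint w ρ a` form a Cantor set of `2 ^ Q` pieces, `Q = ∑ w i`, each a copy of
the whole with the `i`-th coordinate contracted by `ρ ^ w i`, that is, contracted by `ρ` for the
metric of `X` up to a bounded factor. For `ρ < 1 / 2` the pieces are separated, and `ρ` is chosen
to make the dimension `β`. -/
theorem IsBoxEmbedding.dimH_cantor (he : IsBoxEmbedding w C e) (hw : ∀ i, 1 ≤ w i)
    {β : ℝ≥0} (hβ0 : 0 < β) (hβ : (β : ℝ) < (∑ i, w i : ℕ)) :
    ∃ S : Set X, S.Nonempty ∧ S ⊆ range e ∧ dimH S = β := by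
  classical
  set Q : ℕ := ∑ i, w i with hQ
  have hβ' : (0 : ℝ) < β := hβ0
  have hQ0 : Q ≠ 0 := by rintro h; rw [h, Nat.cast_zero] at hβ; linarith
  have hN : Fintype.card (∀ i, Fin (2 ^ w i)) = 2 ^ Q := card_digits w
  let E : Fin (2 ^ Q) ≃ ∀ i, Fin (2 ^ w i) := (Fintype.equivFinOfCardEq hN).symm
  -- The ratio for which `2 ^ Q` pieces, each contracted by `ρ`, have similarity dimension `β`.
  set ρ : ℝ := 2 ^ (-(Q / β) : ℝ) with hρ
  have hρ0 : 0 < ρ := by positivity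
  have hρ1 : ρ < 1 / 2 := by
    have h1 : (1 : ℝ) / 2 = 2 ^ (-1 : ℝ) := by rw [Real.rpow_neg_one]; norm_num
    rw [h1]
    refine Real.rpow_lt_rpow_of_exponent_lt (by norm_num) (neg_lt_neg ?_)
    rwa [lt_div_iff₀ hβ', one_mul]
  have hNρ : ((2 ^ Q : ℕ) : ℝ) * ρ ^ (β : ℝ) = 1 := by
    rw [hρ, ← Real.rpow_mul (by norm_num), neg_mul, div_mul_cancel₀ _ hβ'.ne',
      Real.rpow_neg (by norm_num), Real.rpow_natCast]
    push_cast
    exact mul_inv_cancel₀ (by positivity)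
  let Φ : (ℕ → Fin (2 ^ Q)) → X := fun a => e (cantorPoint w ρ fun n => E (a n))
  refine ⟨range Φ, ⟨Φ fun _ => ⟨0, by positivity⟩, mem_range_self _⟩, ?_, le_antisymm ?_ ?_⟩
  · rintro _ ⟨a, rfl⟩
    exact mem_range_self _
  · refine dimH_range_le_of_codes (N := 2 ^ Q) (ρ := ρ) (C := C * 4) hρ0 (by linarith)
      (mul_nonneg he.nonneg (by norm_num)) hNρ.le (ι := fun m => Fin m → Fin (2 ^ Q))
      (fun m => by simp) (fun m a i => a i) fun m a b hab => ?_
    rw [mul_assoc]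
    refine he.edist_le _ _ _ (by positivity) fun i => ?_
    exact abs_cantorPoint_sub_le hρ0.le hρ1 hw
      (fun n hn => congrArg E (congrFun hab (⟨n, hn⟩ : Fin m))) i
  · refine le_dimH_range_of_separated (ρ := ρ) (c := (1 - 2 * ρ) / 2)
      (Nat.one_lt_two_pow hQ0) hβ0 hρ0 (by linarith) hNρ.ge fun a b m h1 h2 => ?_
    obtain ⟨i, hi⟩ := Function.ne_iff.1 (fun h => h2 (E.injective h))
    have h3 := le_abs_cantorPoint_sub (a := fun n => E (a n)) (b := fun n => E (b n)) hρ0.le hρ1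
      hw (fun n hn => congrArg E (h1 n hn)) hi
    -- Half of the separation constant makes the comparison below strict; its `w i`-th power is no
    -- larger than itself.
    by_contra! hlt
    have hκ : 0 < (1 - 2 * ρ) / 2 := by linarith
    have h4 := (he.abs_sub_le _ _ _ (by positivity) hlt.le i)
    have h5 : ((1 - 2 * ρ) / 2 * ρ ^ m) ^ w i ≤ (1 - 2 * ρ) / 2 * (ρ ^ m) ^ w i := by
      rw [mul_pow]
      gcongr
      exact pow_le_of_le_one hκ.le (by linarith) (by have := hw i; omega)
    have h6 : 0 < (ρ ^ m) ^ w i := by positivity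
    nlinarith [h3.trans (h4.trans h5)]

/-- Each unit cube is covered by `2 ^ (m * ∑ w i)` boxes with sides `2 ^ (-m * w i)`, coded here by
the integer parts of `2 ^ (m * w i)` times the fractional parts of the coordinates. -/
theorem IsBoxEmbedding.dimH_range_le (he : IsBoxEmbedding w C e) :
    dimH (range e) ≤ (∑ i, w i : ℕ) := by
  classical
  have hcover : range e ⊆ ⋃ z : ι → ℤ,
      range fun u : {u : ι → ℝ // ∀ i, ⌊u i⌋ = z i} => e u := by
    rintro _ ⟨u, rfl⟩
    exact mem_iUnion.2 ⟨fun i => ⌊u i⌋, ⟨u, fun _ => rfl⟩, rfl⟩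
  refine (dimH_mono hcover).trans ?_
  rw [dimH_iUnion]
  refine iSup_le fun z => ?_
  have hlt : ∀ (m : ℕ) (x : ℝ), ⌊Int.fract x * 2 ^ m⌋₊ < 2 ^ m := fun m x => by
    rw [Nat.floor_lt (mul_nonneg (Int.fract_nonneg _) (by positivity))]
    push_cast
    exact mul_lt_of_lt_one_left (by positivity) (Int.fract_lt_one x)
  have := dimH_range_le_of_codes (Φ := fun u : {u : ι → ℝ // ∀ i, ⌊u i⌋ = z i} => e u)
    (N := 2 ^ ∑ i, w i) (ρ := 1 / 2) (C := C) (d := (∑ i, w i : ℕ)) (by norm_num) (by norm_num)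
    he.nonneg (by
      rw [NNReal.coe_natCast, Real.rpow_natCast, one_div, inv_pow]
      push_cast
      exact (mul_inv_cancel₀ (by positivity)).le) (ι := fun m => ∀ i, Fin (2 ^ (w i * m)))
    (fun m => by rw [card_digits (fun i => w i * m), ← Finset.sum_mul, pow_mul])
    (fun m u i => ⟨⌊Int.fract (u.1 i) * 2 ^ (w i * m)⌋₊, hlt _ _⟩) fun m u v huv => by
      refine he.edist_le _ _ _ (by positivity) fun i => ?_
      have h1 : ⌊Int.fract (u.1 i) * 2 ^ (w i * m)⌋₊ = ⌊Int.fract (v.1 i) * 2 ^ (w i * m)⌋₊ :=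
        congrArg Fin.val (congrFun huv i)
      have hp : (0 : ℝ) < 2 ^ (w i * m) := by positivity
      have h2 := Nat.floor_le (mul_nonneg (Int.fract_nonneg (u.1 i)) hp.le)
      have h3 := Nat.lt_floor_add_one (Int.fract (u.1 i) * 2 ^ (w i * m))
      have h4 := Nat.floor_le (mul_nonneg (Int.fract_nonneg (v.1 i)) hp.le)
      have h5 := Nat.lt_floor_add_one (Int.fract (v.1 i) * 2 ^ (w i * m))
      rw [h1] at h2 h3
      have h6 : u.1 i - v.1 i = Int.fract (u.1 i) - Int.fract (v.1 i) := by
        rw [Int.fract, Int.fract, u.2 i, v.2 i]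
        ring
      have h7 : |(Int.fract (u.1 i) - Int.fract (v.1 i)) * 2 ^ (w i * m)| ≤ 1 := by
        rw [sub_mul, abs_le]
        constructor <;> linarith
      rw [abs_mul, abs_of_pos hp] at h7
      rwa [h6, ← pow_mul, mul_comm m, one_div, inv_pow, inv_eq_one_div, le_div_iff₀ hp]
  exact_mod_cast this

/-- The extreme dimension `∑ w i` is attained by the whole range, which contains Cantor sets of
every smaller dimension. -/
theorem IsBoxEmbedding.exists_dimH_eq [Nonempty ι] (he : IsBoxEmbedding w C e)
    (hw : ∀ i, 1 ≤ w i) {β : ℝ} (hβ0 : 0 ≤ β) (hβ : β ≤ (∑ i, w i : ℕ)) :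
    ∃ S : Set X, S.Nonempty ∧ S ⊆ range e ∧ dimH S = ENNReal.ofReal β := by
  rcases hβ0.eq_or_lt with rfl | hpos
  · exact ⟨{e 0}, singleton_nonempty _, singleton_subset_iff.2 (mem_range_self _), by simp⟩
  rcases hβ.eq_or_lt with rfl | hlt
  · refine ⟨range e, range_nonempty e, subset_rfl, le_antisymm ?_ ?_⟩
    · rw [ENNReal.ofReal_natCast]
      exact he.dimH_range_le
    · refine le_of_forall_lt fun c hc => ?_
      obtain ⟨d, hd1, hd2⟩ := ENNReal.lt_iff_exists_nnreal_btwn.1 hc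
      have hd0 : 0 < d := by exact_mod_cast (zero_le (a := c)).trans_lt hd1
      obtain ⟨S, -, hS, hdim⟩ := he.dimH_cantor hw hd0 (by
        rw [ENNReal.ofReal_natCast] at hd2
        exact_mod_cast hd2)
      exact hd1.trans_le (hdim ▸ dimH_mono hS)
  · lift β to ℝ≥0 using hβ0
    rw [ENNReal.ofReal_coe_nnreal]
    exact he.dimH_cantor hw (by exact_mod_cast hpos) (by exact_mod_cast hlt)

end BoxEmbedding

namespace Jet

open MeasureTheory Set Filter Topology
open scoped NNReal

variable {k : ℕ}

/-! ### Left invariance -/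

theorem ac_sum {ι : Type*} (S : Finset ι) {f : ι → ℝ → ℝ} {a b : ℝ}
    (h : ∀ i ∈ S, AbsolutelyContinuousOnInterval (f i) a b) :
    AbsolutelyContinuousOnInterval (fun s => ∑ i ∈ S, f i s) a b := by
  classical
  induction S using Finset.induction_on with
  | empty => simpa using ac_const 0 a b
  | insert i S hi ih =>
    simp only [Finset.sum_insert hi]
    exact (h i (Finset.mem_insert_self _ _)).add
      (ih fun j hj => h j (Finset.mem_insert_of_mem hj))

theorem ac_pow {f : ℝ → ℝ} {a b : ℝ} (hf : AbsolutelyContinuousOnInterval f a b) (n : ℕ) :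
    AbsolutelyContinuousOnInterval (fun s => f s ^ n) a b := by
  induction n with
  | zero => simpa using ac_const 1 a b
  | succ n ih =>
    simp only [pow_succ]
    exact ih.mul hf

theorem ac_taylorShift {f : ℝ → ℝ} {a b : ℝ} (hf : AbsolutelyContinuousOnInterval f a b)
    (u : Fin (k + 1) → ℝ) (j : Fin (k + 1)) :
    AbsolutelyContinuousOnInterval (fun s => taylorShift (f s) u j) a b := by
  refine ac_sum _ fun i _ => ?_
  have := (ac_pow hf ((i : ℕ) - (j : ℕ))).const_mul (u i / ((i : ℕ) - (j : ℕ))!)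
  convert! this using 2 with s
  ring

/-- The top coordinate of a jet does not change when the base point moves. -/
theorem taylorShift_last (y : ℝ) (u : Fin (k + 1) → ℝ) :
    taylorShift y u (Fin.last k) = u (Fin.last k) := by
  have : Finset.Ici (Fin.last k) = {Fin.last k} := by
    ext i
    simp [Fin.last_le_iff]
  simp [taylorShift, this]

/-- The Taylor coefficients of a polynomial at a moving base point satisfy the contact equations. -/
theorem hasDerivAt_taylorShift (u : Fin (k + 1) → ℝ) (j : Fin k) (y : ℝ) :
    HasDerivAt (fun z => taylorShift z u j.castSucc) (taylorShift y u j.succ) y := by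
  have h1 : Finset.Ici j.castSucc = insert j.castSucc (Finset.Ici j.succ) := by
    ext i
    simp only [Finset.mem_Ici, Finset.mem_insert, Fin.le_def, Fin.ext_iff, Fin.val_castSucc,
      Fin.val_succ]
    omega
  have h2 : ∀ z, taylorShift z u j.castSucc = u j.castSucc + ∑ i ∈ Finset.Ici j.succ,
      u i * (z ^ ((i : ℕ) - (j : ℕ)) / ((i : ℕ) - (j : ℕ))!) := fun z => by
    rw [taylorShift, h1, Finset.sum_insert (by simp [Fin.le_def])]
    simp
  simp only [h2]
  refine HasDerivAt.const_add _ (HasDerivAt.fun_sum fun i hi => ?_)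
  have hi' : (j : ℕ) + 1 ≤ (i : ℕ) := by simpa [Fin.le_def] using hi
  obtain ⟨n, hn⟩ := Nat.exists_eq_add_of_le hi'
  have e1 : (i : ℕ) - (j : ℕ) = n + 1 := by omega
  have e2 : (i : ℕ) - ((j.succ : Fin (k + 1)) : ℕ) = n := by rw [Fin.val_succ]; omega
  rw [e1, e2]
  have := ((hasDerivAt_pow (n + 1) y).div_const ((n + 1)! : ℝ)).const_mul (u i)
  convert! this using 1
  rw [Nat.factorial_succ]
  push_cast
  have : (n ! : ℝ) ≠ 0 := by positivity
  have : (n + 1 : ℝ) ≠ 0 := by positivity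
  field_simp

theorem IsHorizontal.mul_left {γ : ℝ → Jet k} {a b : ℝ} (hab : a ≤ b) (h : IsHorizontal γ a b)
    (p : Jet k) : IsHorizontal (fun s => p * γ s) a b where
  ac_x := (ac_const p.x a b).add h.ac_x
  ac_u j := by
    simp only [mul_u_eq_taylorShift]
    exact (h.ac_u j).add (ac_taylorShift h.ac_x p.u j)
  contact := by
    have hu : ∀ᵐ s : ℝ, ∀ j, s ∈ uIcc a b → DifferentiableAt ℝ (fun r => (γ r).u j) s :=
      ae_all_iff.2 fun j => (h.ac_u j).ae_differentiableAt
    filter_upwards [h.contact, h.ac_x.ae_differentiableAt, hu] with s hs hx hu hs' j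
    have hsI : s ∈ uIcc a b := by
      rw [uIcc_of_le hab]
      exact Ioo_subset_Icc_self hs'
    have h1 := (hasDerivAt_taylorShift p.u j (γ s).x).comp s (hx hsI).hasDerivAt
    have h2 := (hu j.castSucc hsI).hasDerivAt.add h1
    have e : deriv (fun r => (p * γ r).x) s = deriv (fun r => (γ r).x) s := by
      simp only [mul_x, deriv_const_add]
    rw [e, mul_u_eq_taylorShift, add_mul, ← hs hs' j, ← h2.deriv]
    congr 1
    funext r
    exact mul_u_eq_taylorShift _ _ _

theorem speed_mul_left (p : Jet k) (γ : ℝ → Jet k) (s : ℝ) :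
    speed (fun r => p * γ r) s = speed γ s := by
  simp only [speed, mul_x, mul_u_eq_taylorShift, taylorShift_last, deriv_const_add,
    deriv_add_const]

theorem edist_mul_left_le (p q r : Jet k) : edist (p * q) (p * r) ≤ edist q r := by
  refine le_sInf ?_
  rintro L ⟨γ, a, b, hab, hγ, ha, hb, rfl⟩
  refine sInf_le ⟨fun s => p * γ s, a, b, hab, hγ.mul_left hab p, by simp only [ha],
    by simp only [hb], ?_⟩
  simp only [curveLength, speed_mul_left]

theorem edist_mul_left (p q r : Jet k) : edist (p * q) (p * r) = edist q r := by
  refine le_antisymm (edist_mul_left_le p q r) ?_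
  simpa using edist_mul_left_le p⁻¹ (p * q) (p * r)

theorem edist_one_mul_le (p q : Jet k) : edist 1 (p * q) ≤ edist 1 p + edist 1 q := by
  refine (edist_triangle 1 p (p * q)).trans_eq ?_
  congr 1
  simpa using edist_mul_left p 1 q

/-! ### Lengths of smooth curves -/

theorem edist_le_of_contDiff {γ : ℝ → Jet k} {a b K : ℝ} (hab : a ≤ b) (hK : 0 ≤ K)
    (hx : ContDiff ℝ 1 fun s => (γ s).x) (hu : ∀ j, ContDiff ℝ 1 fun s => (γ s).u j)
    (hc : ∀ s, ∀ j : Fin k, deriv (fun r => (γ r).u j.castSucc) s =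
      (γ s).u j.succ * deriv (fun r => (γ r).x) s)
    (hs : ∀ s ∈ Ioo a b, speed γ s ≤ K) :
    edist (γ a) (γ b) ≤ ENNReal.ofReal (K * (b - a)) := by
  have h1 : IsHorizontal γ a b :=
    ⟨hx.contDiffOn.absolutelyContinuousOnInterval,
      fun j => (hu j).contDiffOn.absolutelyContinuousOnInterval, ae_of_all _ fun s _ => hc s⟩
  refine (sInf_le ⟨γ, a, b, hab, h1, rfl, rfl, rfl⟩ : edist (γ a) (γ b) ≤ _).trans ?_
  calc curveLength γ a b ≤ ∫⁻ _ in Ioo a b, ENNReal.ofReal K :=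
        setLIntegral_mono measurable_const fun s hs' => ENNReal.ofReal_le_ofReal (hs s hs')
    _ = ENNReal.ofReal (K * (b - a)) := by
        rw [setLIntegral_const, Real.volume_Ioo, ENNReal.ofReal_mul hK]

/-- A jet section is a horizontal curve whose speed at `s` is `√(1 + f^{(k+1)}(s)²)`. -/
theorem edist_jetOf_le {f : ℝ → ℝ} (hf : ContDiff ℝ ∞ f) {y z M : ℝ} (hyz : y ≤ z) (hM : 0 ≤ M)
    (h : ∀ s ∈ Ioo y z, |iteratedDeriv (k + 1) f s| ≤ M) :
    edist (jetOf k f y) (jetOf k f z) ≤ ENNReal.ofReal ((1 + M) * (z - y)) := by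
  have hsm : ∀ n : ℕ, ContDiff ℝ 1 (iteratedDeriv n f) := fun n =>
    (contDiff_nat_succ_iff_contDiff_one_iteratedDeriv.1 (hf.of_le (by exact_mod_cast le_top))).2
  refine edist_le_of_contDiff hyz (by positivity) contDiff_id (fun j => hsm j) (fun s j => ?_)
    fun s hs => ?_
  · simp [jetOf, iteratedDeriv_succ]
  · have e : speed (fun y => jetOf k f y) s = √(1 + iteratedDeriv (k + 1) f s ^ 2) := by
      simp [speed, jetOf, iteratedDeriv_succ]
    change speed (fun y => jetOf k f y) s ≤ _
    rw [e]
    refine Real.sqrt_le_iff.2 ⟨by positivity, ?_⟩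
    have := sq_le_sq' (abs_le.1 (h s hs)).1 (abs_le.1 (h s hs)).2
    nlinarith

theorem lipschitzWith_x : LipschitzWith 1 (x : Jet k → ℝ) := by
  intro p q
  rw [ENNReal.coe_one, one_mul, edist_comm]
  refine le_sInf ?_
  rintro L ⟨γ, a, b, hab, hγ, rfl, rfl, rfl⟩
  by_cases hL : curveLength γ a b = ⊤
  · rw [hL]; exact le_top
  rw [edist_dist, Real.dist_eq, ← ENNReal.ofReal_toReal hL]
  refine ENNReal.ofReal_le_ofReal ?_
  have := abs_sub_le_of_deriv_le (g := fun r => (γ r).x) zero_le_one ENNReal.toReal_nonneg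
    hγ.ac_x (Filter.Eventually.of_forall fun r _ => by
      rw [one_mul]; exact abs_deriv_x_le_speed γ r) (ENNReal.ofReal_toReal hL).ge ⟨hab, le_rfl⟩
  simpa using this

/-- A smooth jet section preserves Hausdorff dimension: it is locally Lipschitz because it is a
smooth horizontal curve, and the base point is a Lipschitz left inverse. -/
theorem dimH_image_jetOf {f : ℝ → ℝ} (hf : ContDiff ℝ ∞ f) (S : Set ℝ) :
    dimH (jetOf k f '' S) = dimH S := by
  refine le_antisymm (dimH_image_le_of_locally_lipschitzOn fun y _ => ?_) ?_
  · have hcont : Continuous (iteratedDeriv (k + 1) f) :=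
      hf.continuous_iteratedDeriv _ (by exact_mod_cast le_top)
    obtain ⟨M, hM⟩ := isCompact_Icc.exists_bound_of_continuousOn
      (hcont.continuousOn (s := Icc (y - 1) (y + 1)))
    have hM0 : 0 ≤ M := (norm_nonneg _).trans (hM y ⟨by linarith, by linarith⟩)
    refine ⟨Real.toNNReal (1 + M), Icc (y - 1) (y + 1),
      mem_nhdsWithin_of_mem_nhds (Icc_mem_nhds (by linarith) (by linarith)), ?_⟩
    have key : ∀ v ∈ Icc (y - 1) (y + 1), ∀ w ∈ Icc (y - 1) (y + 1), v ≤ w →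
        edist (jetOf k f v) (jetOf k f w) ≤ Real.toNNReal (1 + M) * edist v w := by
      intro v hv w hw hvw
      have e : (Real.toNNReal (1 + M) : ℝ≥0∞) * edist v w =
          ENNReal.ofReal ((1 + M) * (w - v)) := by
        rw [edist_dist, dist_comm, Real.dist_eq, abs_of_nonneg (sub_nonneg.2 hvw),
          ENNReal.ofReal_mul (by positivity)]
        rfl
      rw [e]
      exact edist_jetOf_le hf hvw hM0 fun s hs =>
        hM s ⟨hv.1.trans hs.1.le, hs.2.le.trans hw.2⟩
    intro v hv w hw
    rcases le_total v w with hvw | hvw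
    · exact key v hv w hw hvw
    · rw [edist_comm, edist_comm v]
      exact key w hw v hv hvw
  · have h := lipschitzWith_x.dimH_image_le (jetOf k f '' S)
    rwa [image_image, show (fun y => (jetOf k f y).x) = id from rfl, image_id] at h

/-! ### The distance on a vertical fibre -/

theorem mk_zero_mul (y : ℝ) (q : Jet k) : (⟨y, 0⟩ : Jet k) * q = ⟨y + q.x, q.u⟩ := by
  ext s
  · rfl
  · simp [mul_u]

theorem vertical_mul (u v : Fin (k + 1) → ℝ) : (⟨0, u⟩ : Jet k) * ⟨0, v⟩ = ⟨0, u + v⟩ := by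
  ext s
  · simp [mul_x]
  · rw [mul_u_eq_taylorShift, taylorShift_zero]
    exact add_comm _ _

/-- The points over `t` form a left coset of the abelian group of jets with base point `0`. -/
theorem edist_fibre (t : ℝ) (u v : Fin (k + 1) → ℝ) :
    edist (⟨t, u⟩ : Jet k) ⟨t, v⟩ = edist 1 (⟨0, v - u⟩ : Jet k) := by
  have h1 : ∀ w : Fin (k + 1) → ℝ, (⟨t, w⟩ : Jet k) = ⟨t, 0⟩ * (⟨0, u⟩ * ⟨0, w - u⟩) := fun w => by
    rw [vertical_mul, mk_zero_mul]
    simp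
  rw [h1 u, h1 v, edist_mul_left, edist_mul_left, sub_self]
  rfl

theorem edist_one_base_le (y : ℝ) : edist 1 (⟨y, 0⟩ : Jet k) ≤ ENNReal.ofReal |y| := by
  have h := edist_le_of_contDiff (k := k) (γ := fun s => ⟨s * y, 0⟩) (a := 0) (b := 1)
    (K := |y|) zero_le_one (abs_nonneg y) (by fun_prop) (fun j => contDiff_const)
    (fun s j => by simp)
    (fun s _ => by simp [speed, Real.sqrt_sq_eq_abs])
  simp only [zero_mul, one_mul, sub_zero, mul_one] at h
  exact h

theorem edist_one_top_le (c : ℝ) :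
    edist 1 (⟨0, Pi.single (Fin.last k) c⟩ : Jet k) ≤ ENNReal.ofReal |c| := by
  have h := edist_le_of_contDiff (k := k) (γ := fun s => ⟨0, Pi.single (Fin.last k) (s * c)⟩)
    (a := 0) (b := 1) (K := |c|) zero_le_one (abs_nonneg c) contDiff_const
    (fun j => by
      by_cases hj : j = Fin.last k
      · subst hj
        simp only [Pi.single_eq_same]
        fun_prop
      · simp only [Pi.single_eq_of_ne hj]
        exact contDiff_const)
    (fun s j => by simp)
    (fun s _ => by simp [speed, Real.sqrt_sq_eq_abs])
  simp only [zero_mul, one_mul, sub_zero, mul_one, Pi.single_zero] at h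
  exact h

/-- Conjugating the top vertical direction by the flow of `X` for time `y` gives the vertical vector
of Taylor coefficients of `c y^k / k!`. -/
theorem edist_one_moment_le (c y : ℝ) :
    edist 1 (⟨0, fun s => c * (y ^ (k - (s : ℕ)) / (k - (s : ℕ))!)⟩ : Jet k) ≤
      ENNReal.ofReal (|c| + 2 * |y|) := by
  have h1 : (⟨0, fun s => c * (y ^ (k - (s : ℕ)) / (k - (s : ℕ))!)⟩ : Jet k) =
      ⟨-y, 0⟩ * (⟨0, Pi.single (Fin.last k) c⟩ * ⟨y, 0⟩) := by
    rw [mk_zero_mul]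
    ext s
    · simp [mul_x]
    · simp only [mul_u_eq_taylorShift, taylorShift, Pi.zero_apply, zero_add]
      rw [Finset.sum_eq_single (Fin.last k)]
      · simp
      · intro j _ hj
        rw [Pi.single_eq_of_ne hj, zero_mul]
      · intro h
        exact absurd (Finset.mem_Ici.2 (Fin.le_last s)) h
  rw [h1]
  calc _ ≤ ENNReal.ofReal |-y| + (ENNReal.ofReal |c| + ENNReal.ofReal |y|) :=
        (edist_one_mul_le _ _).trans (add_le_add (edist_one_base_le _)
          ((edist_one_mul_le _ _).trans (add_le_add (edist_one_top_le _) (edist_one_base_le _))))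
    _ = _ := by
        rw [← ENNReal.ofReal_add (by positivity) (by positivity),
          ← ENNReal.ofReal_add (by positivity) (by positivity), abs_neg]
        congr 1
        ring

theorem edist_one_sum_le {ι : Type*} (S : Finset ι) (v : ι → Fin (k + 1) → ℝ) :
    edist 1 (⟨0, ∑ i ∈ S, v i⟩ : Jet k) ≤ ∑ i ∈ S, edist 1 (⟨0, v i⟩ : Jet k) := by
  classical
  induction S using Finset.induction_on with
  | empty => exact (edist_self (1 : Jet k)).le
  | insert i S hi ih =>
    rw [Finset.sum_insert hi, Finset.sum_insert hi, ← vertical_mul]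
    exact (edist_one_mul_le _ _).trans (add_le_add le_rfl ih)

/-- The moment vectors at the nodes `0, …, k` span the vertical fibre. -/
theorem exists_moment_coeff (k : ℕ) : ∃ c : Fin (k + 1) → Fin (k + 1) → ℝ, ∀ s s' : Fin (k + 1),
    ∑ i, c s i * ((i : ℝ) ^ (k - (s' : ℕ)) / (k - (s' : ℕ))!) = if s = s' then 1 else 0 := by
  set V : Matrix (Fin (k + 1)) (Fin (k + 1)) ℝ := Matrix.vandermonde fun i => ((i : ℕ) : ℝ) with hV
  have hdet : IsUnit V.det := isUnit_iff_ne_zero.2 (Matrix.det_vandermonde_ne_zero_iff.2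
    fun i j h => Fin.ext (by exact_mod_cast h))
  refine ⟨fun s i => (k - (s : ℕ))! * V⁻¹ s.rev i, fun s s' => ?_⟩
  have h1 := congrFun (congrFun (Matrix.nonsing_inv_mul V hdet) s.rev) s'.rev
  rw [Matrix.mul_apply, Matrix.one_apply] at h1
  simp only [Fin.rev_inj] at h1
  have h2 : ∀ i : Fin (k + 1), V i s'.rev = ((i : ℕ) : ℝ) ^ (k - (s' : ℕ)) := fun i => by
    rw [hV, Matrix.vandermonde_apply, Fin.val_rev, Nat.add_sub_add_right]
  have h3 : ∀ i : Fin (k + 1), (k - (s : ℕ))! * V⁻¹ s.rev i *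
      (((i : ℕ) : ℝ) ^ (k - (s' : ℕ)) / (k - (s' : ℕ))!) =
      ((k - (s : ℕ))! / (k - (s' : ℕ))! : ℝ) * (V⁻¹ s.rev i * V i s'.rev) := fun i => by
    rw [h2]
    ring
  rw [Finset.sum_congr rfl fun i _ => h3 i, ← Finset.mul_sum, h1]
  split_ifs with h
  · rw [h, mul_one]
    exact div_self (by positivity)
  · rw [mul_zero]

/-- Upper half of the ball-box estimate on the vertical subgroup. The vector `v` is rescaled by the
dilation of ratio `1 / r` to a bounded one, which is a bounded combination of the moment vectors at
the nodes `0, …, k`; scaling back, `v` is a combination, with coefficients of order `r`, of the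
moment vectors at the nodes `0, r, …, k r`. -/
theorem exists_edist_one_vertical_le (k : ℕ) : ∃ C : ℝ, 0 ≤ C ∧ ∀ (v : Fin (k + 1) → ℝ) (r : ℝ),
    0 < r → (∀ s, |v s| ≤ r ^ (k + 1 - (s : ℕ))) →
    edist 1 (⟨0, v⟩ : Jet k) ≤ ENNReal.ofReal (C * r) := by
  obtain ⟨c, hc⟩ := exists_moment_coeff k
  refine ⟨∑ i : Fin (k + 1), (∑ s, |c s i| + 2 * ((i : ℕ) : ℝ)), by positivity,
    fun v r hr hv => ?_⟩
  -- The coordinates of the image of `v` under the dilation by `1 / r`.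
  set v' : Fin (k + 1) → ℝ := fun s => v s / r ^ (k + 1 - (s : ℕ)) with hv'
  have hv1 : ∀ s, |v' s| ≤ 1 := fun s => by
    rw [hv', abs_div, abs_of_pos (by positivity : 0 < r ^ (k + 1 - (s : ℕ)))]
    exact (div_le_one (by positivity)).2 (hv s)
  set d : Fin (k + 1) → ℝ := fun i => r * ∑ s, v' s * c s i with hd
  have hsum : v = ∑ i : Fin (k + 1), fun s : Fin (k + 1) =>
      d i * ((r * ((i : ℕ) : ℝ)) ^ (k - (s : ℕ)) / (k - (s : ℕ))!) := by
    funext s'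
    have hpow : r ^ (k + 1 - (s' : ℕ)) = r * r ^ (k - (s' : ℕ)) := by
      rw [← pow_succ', Nat.succ_sub (by omega)]
    have h1 : v s' = r ^ (k + 1 - (s' : ℕ)) * ∑ s, v' s * if s = s' then 1 else 0 := by
      simp only [mul_ite, mul_one, mul_zero, Finset.sum_ite_eq', Finset.mem_univ, if_true, hv']
      field_simp
    rw [h1, Finset.sum_apply]
    simp only [← hc, Finset.mul_sum, hd, Finset.sum_mul]
    rw [Finset.sum_comm]
    refine Finset.sum_congr rfl fun i _ => Finset.sum_congr rfl fun s _ => ?_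
    rw [hpow, mul_pow]
    ring
  have hd1 : ∀ i, |d i| ≤ r * ∑ s, |c s i| := fun i => by
    rw [hd, abs_mul, abs_of_pos hr]
    gcongr
    refine (Finset.abs_sum_le_sum_abs _ _).trans (Finset.sum_le_sum fun s _ => ?_)
    rw [abs_mul]
    exact mul_le_of_le_one_left (abs_nonneg _) (hv1 s)
  rw [hsum]
  refine (edist_one_sum_le _ _).trans ?_
  rw [Finset.sum_mul, ENNReal.ofReal_sum_of_nonneg fun i _ => by positivity]
  refine Finset.sum_le_sum fun i _ =>
    (edist_one_moment_le _ _).trans (ENNReal.ofReal_le_ofReal ?_)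
  have h1 : |r * ((i : ℕ) : ℝ)| = r * ((i : ℕ) : ℝ) := abs_of_nonneg (by positivity)
  rw [h1]
  linarith [hd1 i]

/-- Along a horizontal curve of length `L` from the identity each contact equation contributes one
more factor `L`, from the top coordinate downwards. -/
theorem abs_u_le_pow {γ : ℝ → Jet k} {a b L : ℝ} (hγ : IsHorizontal γ a b) (ha : γ a = 1)
    (hL : 0 ≤ L) (hlen : curveLength γ a b ≤ ENNReal.ofReal L) (j : Fin (k + 1)) :
    ∀ s ∈ Icc a b, |(γ s).u j| ≤ L ^ (k + 1 - (j : ℕ)) := by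
  induction j using Fin.reverseInduction with
  | last =>
    intro s hs
    have := abs_sub_le_of_deriv_le (g := fun r => (γ r).u (Fin.last k)) zero_le_one hL
      (hγ.ac_u _) (ae_of_all _ fun r _ => by
        rw [one_mul]; exact abs_deriv_last_le_speed γ r) hlen hs
    simpa [ha, one_u] using this
  | cast j ih =>
    intro s hs
    have := abs_sub_le_of_deriv_le (g := fun r => (γ r).u j.castSucc)
      (K := L ^ (k - (j : ℕ))) (by positivity) hL (hγ.ac_u _) (by
        filter_upwards [hγ.contact] with r hr hr'
        rw [hr hr' j, abs_mul]
        have h1 := ih r (Ioo_subset_Icc_self hr')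
        rw [Fin.val_succ, Nat.add_sub_add_right] at h1
        exact mul_le_mul h1 (abs_deriv_x_le_speed γ r) (abs_nonneg _) (by positivity)) hlen hs
    simp only [ha, one_u, sub_zero] at this
    rwa [Fin.val_castSucc, Nat.succ_sub j.2.le, pow_succ]

/-- Lower half of the ball-box estimate on the vertical subgroup. -/
theorem abs_le_of_edist_one_vertical_le {v : Fin (k + 1) → ℝ} {r : ℝ} (hr : 0 < r)
    (h : edist 1 (⟨0, v⟩ : Jet k) ≤ ENNReal.ofReal r) (j : Fin (k + 1)) :
    |v j| ≤ r ^ (k + 1 - (j : ℕ)) := by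
  have h1 : ∀ L, r < L → |v j| ≤ L ^ (k + 1 - (j : ℕ)) := by
    intro L hL
    have h2 : ccDist 1 (⟨0, v⟩ : Jet k) < ENNReal.ofReal L :=
      lt_of_le_of_lt h ((ENNReal.ofReal_lt_ofReal_iff (hr.trans hL)).2 hL)
    obtain ⟨M, ⟨γ, a, b, hab, hγ, ha, hb, rfl⟩, hM⟩ := sInf_lt_iff.1 h2
    have := abs_u_le_pow hγ ha (hr.trans hL).le hM.le j b ⟨hab, le_rfl⟩
    rwa [hb] at this
  have h3 : Tendsto (fun L : ℝ => L ^ (k + 1 - (j : ℕ))) (𝓝[>] r) (𝓝 (r ^ (k + 1 - (j : ℕ)))) :=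
    ((continuous_pow _).tendsto r).mono_left nhdsWithin_le_nhds
  exact ge_of_tendsto h3 (eventually_nhdsWithin_of_forall fun L hL => h1 L hL)

/-- The ball-box theorem on a vertical fibre. -/
theorem exists_isBoxEmbedding_fibre (k : ℕ) (t : ℝ) : ∃ C : ℝ,
    IsBoxEmbedding (fun s : Fin (k + 1) => k + 1 - (s : ℕ)) C fun u => (⟨t, u⟩ : Jet k) := by
  obtain ⟨C, hC, H⟩ := exists_edist_one_vertical_le k
  refine ⟨C, hC, fun u v r hr h => ?_, fun u v r hr h i => ?_⟩
  · rw [edist_fibre]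
    refine H _ r hr fun s => ?_
    rw [Pi.sub_apply, abs_sub_comm]
    exact h s
  · rw [edist_fibre] at h
    rw [abs_sub_comm]
    exact abs_le_of_edist_one_vertical_le hr h i

theorem sum_weights (k : ℕ) :
    ((∑ s : Fin (k + 1), (k + 1 - (s : ℕ)) : ℕ) : ℝ) = ((k : ℝ) + 1) * ((k : ℝ) + 2) / 2 := by
  have h1 : ∑ s : Fin (k + 1), (k + 1 - (s : ℕ)) = ∑ i ∈ Finset.range (k + 1), (i + 1) := by
    rw [Fin.sum_univ_eq_sum_range fun i => k + 1 - i, ← Finset.sum_range_reflect]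
    refine Finset.sum_congr rfl fun i hi => ?_
    have := Finset.mem_range.1 hi
    omega
  have h2 : ∀ n : ℕ, ((∑ i ∈ Finset.range n, (i + 1) : ℕ) : ℝ) = n * (n + 1) / 2 := fun n => by
    induction n with
    | zero => simp
    | succ n ih =>
      rw [Finset.sum_range_succ, Nat.cast_add, ih]
      push_cast
      ring
  rw [h1, h2]
  push_cast
  ring

/-! ### The horizontal and vertical parts of a product -/

theorem verticalMap_x (f : ℝ → ℝ) (t : ℝ) (p : Jet k) : (verticalMap f t p).x = t := by
  simp [verticalMap, mul_x, inv_x, jetOf]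

theorem horizontalMap_mul_jetOf (f : ℝ → ℝ) {t : ℝ} {b : Jet k} (hb : b.x = t) (y : ℝ) :
    horizontalMap f t (b * jetOf k f y) = jetOf k f y := by
  have h : (b * jetOf k f y).x - t = y := by simp [mul_x, hb, jetOf]
  rw [horizontalMap, h]

theorem verticalMap_mul_jetOf (f : ℝ → ℝ) {t : ℝ} {b : Jet k} (hb : b.x = t) (y : ℝ) :
    verticalMap f t (b * jetOf k f y) = b := by
  have h : (b * jetOf k f y).x - t = y := by simp [mul_x, hb, jetOf]
  rw [verticalMap, h, mul_inv_cancel_right]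

end Jet

/-! ### Sets of prescribed dimensions -/

theorem isBoxEmbedding_real :
    IsBoxEmbedding (fun _ : Unit => 1) 1 fun u : Unit → ℝ => u () where
  nonneg := zero_le_one
  edist_le u v r _ h := by
    rw [edist_dist, Real.dist_eq, one_mul]
    exact ENNReal.ofReal_le_ofReal (by simpa using h ())
  abs_sub_le u v r hr h i := by
    rw [edist_dist, Real.dist_eq, ENNReal.ofReal_le_ofReal_iff hr.le] at h
    simpa using h

theorem mainTheorem1 (k : ℕ) (hk : 1 ≤ k) (f : ℝ → ℝ) (hf : ContDiff ℝ ∞ f) (t : ℝ) :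
    (∀ E : Set (Jet k),
      dimH (Jet.horizontalMap f t '' E) ∈ Set.Icc (0 : ℝ≥0∞) 1 ∧
      dimH (Jet.verticalMap f t '' E) ∈
        Set.Icc (0 : ℝ≥0∞) (ENNReal.ofReal (((k : ℝ) + 1) * ((k : ℝ) + 2) / 2))) ∧
    (∀ α ∈ Set.Icc (0 : ℝ) 1, ∀ β ∈ Set.Icc (0 : ℝ) (((k : ℝ) + 1) * ((k : ℝ) + 2) / 2),
      ∃ E : Set (Jet k),
        dimH (Jet.horizontalMap f t '' E) = ENNReal.ofReal α ∧
        dimH (Jet.verticalMap f t '' E) = ENNReal.ofReal β) := by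
  obtain ⟨C, hC⟩ := Jet.exists_isBoxEmbedding_fibre k t
  refine ⟨fun E => ⟨⟨zero_le, ?_⟩, ⟨zero_le, ?_⟩⟩, ?_⟩
  · calc dimH (Jet.horizontalMap f t '' E) ≤ dimH (Jet.jetOf k f '' Set.univ) := by
          refine dimH_mono ?_
          rintro _ ⟨p, -, rfl⟩
          exact ⟨p.x - t, Set.mem_univ _, rfl⟩
      _ = 1 := by rw [Jet.dimH_image_jetOf hf, Real.dimH_univ]
  · rw [← Jet.sum_weights, ENNReal.ofReal_natCast]
    refine (dimH_mono ?_).trans hC.dimH_range_le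
    rintro _ ⟨p, -, rfl⟩
    exact ⟨(Jet.verticalMap f t p).u, Jet.ext (Jet.verticalMap_x f t p).symm rfl⟩
  · rintro α ⟨hα0, hα1⟩ β ⟨hβ0, hβ1⟩
    obtain ⟨A, ⟨a₀, ha₀⟩, -, hA⟩ := isBoxEmbedding_real.exists_dimH_eq (fun _ => le_rfl) hα0
      (by simpa using hα1)
    obtain ⟨B, ⟨b₀, hb₀⟩, hBt, hB⟩ := hC.exists_dimH_eq (fun s => by omega) hβ0
      (by rwa [Jet.sum_weights])
    have hBx : ∀ b ∈ B, b.x = t := fun b hb => by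
      obtain ⟨u, rfl⟩ := hBt hb
      rfl
    -- Every point of `A` is used as a base point and every point of `B` as a vertical part.
    refine ⟨Set.image2 (fun a b => b * Jet.jetOf k f a) A B, ?_, ?_⟩
    · rw [Set.image_image2]
      have h : Set.image2 (fun a b => Jet.horizontalMap f t (b * Jet.jetOf k f a)) A B =
          Jet.jetOf k f '' A := by
        rw [Set.image2_congr fun a _ b hb => Jet.horizontalMap_mul_jetOf f (hBx b hb) a]
        exact (Set.image_image2 (fun a _ => a) _).symm.trans
          (congrArg _ (Set.image2_left ⟨b₀, hb₀⟩))
      rw [h, Jet.dimH_image_jetOf hf, hA]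
    · rw [Set.image_image2]
      have h : Set.image2 (fun a b => Jet.verticalMap f t (b * Jet.jetOf k f a)) A B = B := by
        rw [Set.image2_congr fun a _ b hb => Jet.verticalMap_mul_jetOf f (hBx b hb) a,
          Set.image2_right ⟨a₀, ha₀⟩]
      rw [h, hB]
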